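/- **Setting.** A network is a finite connected simple graph $(\mathcal N,\mathcal E)$ with at least three nodes; it is *weakly cyclic* if no edge belongs to more than one cycle. A *market* on it consists of demands $d_n\ge 0$ with total $D=\sum_n d_n>0$; a set $\mathcal N_g\subseteq\mathcal N$ of generators, $|\mathcal N_g|>2$; cost functions $c_n$ $(n\in\mathcal N_g)$ that are convex, strictly increasing and differentiable on $[0,\infty)$ with $c_n(0)=0$; capacity limits $\underline s_n\ge 0$, $\bar s_n$; flow limits $f_{nm}\ge 0$ and admittances $B_{nm}>0$ on the edges. It is assumed that $\sum_{m\in\mathcal N_g,m\ne n}\bar s_m>D$ for all $n\in\mathcal N_g$. A supply profile $(s_n)_{n\in\mathcal N_g}$ is *feasible* if $\sum_n s_n=D$, $\underline s_n\le s_n\le\bar s_n$, and the linearized (DC) power flow with injections $s_n-d_n$ (with $s_n:=0$ for $n\notin\mathcal N_g$) satisfies the flow limits; it is assumed that some profile satisfies all these inequalities strictly. A *social optimum* $s^*$ minimizes $\sum_n c_n(s_n)$ over feasible profiles. Suppliers choose $w_n\ge 0$; the price is $p(w)=\sum_{n\in\mathcal N_g} w_n/((|\mathcal N_g|-1)D)$,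 which must be positive, and supplier $n$ produces $S_n(w)=D-w_n/p(w)$ with profit $p(w)S_n(w)-c_n(S_n(w))$. A *supply function equilibrium* (SFE) is a $w$ such that, for each $n\in\mathcal N_g$, $w_n$ maximizes the profit of $n$ given $w_{-n}$, among the actions for which $\underline s_n\le S_n\le\bar s_n$ and the flow limits hold. The price of anarchy (PoA) is the ratio $\sum_n c_n(S_n(w))/\sum_n c_n(s^*_n)$ of the total cost at an SFE $w$ to that at a social optimum $s^*$; it is well defined if SFE and optima exist and all of them give the same ratio. For each node $n$ fix a partition $\mathcal P(n)$ of its set of neighbors $\mathcal N(n)$ into singletons and duples such that each duple consists of the two neighbors of $n$ on some cycle, and no two singletons lie on a common cycle; for each duple in $\mathcal P(n)$ fix such a cycle $C$. The effective flow limit is $\hat f_{nm}=f_{nm}$ if $\{m\}\in\mathcal P(n)$, and $\hat f_{nm}=\min\{f_{nm},\,B_{nm}\sum_{jk\in \mathcal E(C),\,jk\ne nm} f_{jk}/B_{jk}\}$ if $m$ is in a duple with cycle $C$. The upper bound on the PoA is $$\beta = 1+\max_{n\in\mathcal N_g}\frac{\min\{\bar s_n,\ D-\sum_{m\in\mathcal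 N_g,m\ne n}\underline s_m,\ d_n+\sum_{m\in\mathcal N(n)}\hat f_{nm}\}}{(|\mathcal N_g|-2)D}.$$ **Theorem.** For every weakly cyclic network, such partitions and cycles exist, and for every $\varepsilon>0$ there are demands, a set of generators, cost functions, capacity limits, flow limits and admittances forming a market as above, for which the PoA is well defined and, for every choice of the partitions and cycles, $$\beta = 1+\max_{n\in\mathcal N_g}\frac{d_n+\sum_{m\in\mathcal N(n)}\hat f_{nm}}{(|\mathcal N_g|-2)D}\qquad\text{and}\qquad |\mathrm{PoA}-\beta|\le\varepsilon .$$ -/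

import Mathlib

namespace PowerMarket

section Graph

variable {V : Type*} [Fintype V] [DecidableEq V]

/-- `C` is the set of edges of a cycle of `G`: a closed walk through at least three distinct nodes.
A cycle is identified with its edge set, so the starting node and the orientation do not matter. -/
def IsCycleSet (G : SimpleGraph V) (C : Finset (Sym2 V)) : Prop :=
  ∃ (u : V) (p : G.Walk u u), p.IsCycle ∧ p.edges.toFinset = C

/-- A weakly-cyclic network: no edge belongs to more than one cycle. -/
def IsWeaklyCyclic (G : SimpleGraph V) : Prop :=
  ∀ C C' : Finset (Sym2 V), IsCycleSet G C → IsCycleSet G C' → ∀ e ∈ C, e ∈ C' → C = C'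

/-- For every node `n`, a partition of the neighbors of `n` into singletons and duples, and
a choice of a cycle for each duple, such that the two members of a duple are the two neighbors of
`n` on the chosen cycle, and no two singletons lie on a common cycle. -/
structure NeighborPartition (G : SimpleGraph V) [DecidableRel G.Adj] where
  /-- the partition of the neighbors of `n` -/
  parts : ∀ n : V, Finpartition (G.neighborFinset n)
  /-- the cycle (as an edge set) chosen for a duple of the partition at `n` -/
  cyc : V → Finset V → Finset (Sym2 V)
  card_part : ∀ n, ∀ S ∈ (parts n).parts, S.card = 1 ∨ S.card = 2
  isCycleSet_cyc : ∀ n, ∀ S ∈ (parts n).parts, S.card = 2 → IsCycleSet G (cyc n S)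
  mem_cyc : ∀ n, ∀ S ∈ (parts n).parts, S.card = 2 → ∀ i ∈ S, s(n, i) ∈ cyc n S
  singletons : ∀ n i j, i ≠ j → {i} ∈ (parts n).parts → {j} ∈ (parts n).parts →
    ¬ ∃ C, IsCycleSet G C ∧ (∃ e ∈ C, i ∈ e) ∧ (∃ e ∈ C, j ∈ e)

end Graph

/-- The data of an electricity market on the node set `V`. Cost functions, capacity limits,
supplies and actions matter only at the generator nodes `gens`; flow limits and admittances matter
only at the edges of the network. -/
structure Market (V : Type*) where
  /-- inelastic demand -/
  d : V → ℝ
  /-- nodes with a generator -/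
  gens : Finset V
  /-- cost functions -/
  cost : V → ℝ → ℝ
  /-- lower capacity limits -/
  slo : V → ℝ
  /-- upper capacity limits -/
  shi : V → ℝ
  /-- flow limits of the lines -/
  f : Sym2 V → ℝ
  /-- admittances of the lines -/
  B : Sym2 V → ℝ

namespace Market

variable {V : Type*} [Fintype V] [DecidableEq V]

/-- Total demand. -/
def totalDemand (M : Market V) : ℝ := ∑ j, M.d j

/-- Net power injection at node `i` under the supply profile `s`. -/
def injection (M : Market V) (s : V → ℝ) (i : V) : ℝ :=
  (if i ∈ M.gens then s i else 0) - M.d i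

/-- `θ` are voltage angles of the linearized (DC) power flow for the supply profile `s`:
line `i j` carries `B i j * (θ i - θ j)` from `i` to `j`, and the net outflow of every node is its
injection. On a connected network with positive admittances and balanced injections, such `θ`
exist and are unique up to an additive constant, and the line flows they induce are the image of
the injections under the shift-factor matrix. -/
def IsAngle (G : SimpleGraph V) [DecidableRel G.Adj] (M : Market V) (s θ : V → ℝ) : Prop :=
  ∀ i, ∑ j ∈ G.neighborFinset i, M.B s(i, j) * (θ i - θ j) = M.injection s i

/-- The line flows under `s` respect the flow limits. -/
def FlowOK (G : SimpleGraph V) [DecidableRel G.Adj] (M : Market V) (s : V → ℝ) : Prop :=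
  ∃ θ, M.IsAngle G s θ ∧ ∀ i j, G.Adj i j → |M.B s(i, j) * (θ i - θ j)| ≤ M.f s(i, j)

/-- The line flows under `s` respect the flow limits strictly. -/
def FlowStrict (G : SimpleGraph V) [DecidableRel G.Adj] (M : Market V) (s : V → ℝ) : Prop :=
  ∃ θ, M.IsAngle G s θ ∧ ∀ i j, G.Adj i j → |M.B s(i, j) * (θ i - θ j)| < M.f s(i, j)

/-- The standing assumptions on a market over the network `G`. -/
structure IsAdmissible (G : SimpleGraph V) [DecidableRel G.Adj] (M : Market V) : Prop where
  demand_nonneg : ∀ n, 0 ≤ M.d n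
  totalDemand_pos : 0 < M.totalDemand
  two_lt_card : 2 < M.gens.card
  cost_zero : ∀ n ∈ M.gens, M.cost n 0 = 0
  cost_convex : ∀ n ∈ M.gens, ConvexOn ℝ (Set.Ici 0) (M.cost n)
  cost_strictMono : ∀ n ∈ M.gens, StrictMonoOn (M.cost n) (Set.Ici 0)
  cost_differentiable : ∀ n ∈ M.gens, DifferentiableOn ℝ (M.cost n) (Set.Ici 0)
  slo_nonneg : ∀ n ∈ M.gens, 0 ≤ M.slo n
  admittance_pos : ∀ e ∈ G.edgeSet, 0 < M.B e
  flowLimit_nonneg : ∀ e ∈ G.edgeSet, 0 ≤ M.f e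
  /-- every generator is dispensable -/
  dispensable : ∀ n ∈ M.gens, M.totalDemand < ∑ m ∈ M.gens.erase n, M.shi m
  /-- there is a strictly feasible supply profile -/
  strictly_feasible : ∃ s : V → ℝ, ∑ n ∈ M.gens, s n = M.totalDemand ∧
    (∀ n ∈ M.gens, M.slo n < s n ∧ s n < M.shi n) ∧ M.FlowStrict G s

/-- Feasible supply profiles of the economic dispatch problem. -/
def IsFeasible (G : SimpleGraph V) [DecidableRel G.Adj] (M : Market V) (s : V → ℝ) : Prop :=
  ∑ n ∈ M.gens, s n = M.totalDemand ∧ (∀ n ∈ M.gens, M.slo n ≤ s n ∧ s n ≤ M.shi n) ∧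
    M.FlowOK G s

/-- Total generation cost. -/
def totalCost (M : Market V) (s : V → ℝ) : ℝ := ∑ n ∈ M.gens, M.cost n (s n)

/-- Socially optimal supply profiles. -/
def IsSocialOptimum (G : SimpleGraph V) [DecidableRel G.Adj] (M : Market V) (s : V → ℝ) : Prop :=
  M.IsFeasible G s ∧ ∀ s', M.IsFeasible G s' → M.totalCost s ≤ M.totalCost s'

/-- The market clearing price at the action profile `w`. -/
noncomputable def price (M : Market V) (w : V → ℝ) : ℝ :=
  (∑ n ∈ M.gens, w n) / (((M.gens.card : ℝ) - 1) * M.totalDemand)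

/-- The supply profile at the action profile `w`: supplier `n` bids the supply function
`p ↦ D - w n / p`, evaluated at the market clearing price. -/
noncomputable def supply (M : Market V) (w : V → ℝ) (n : V) : ℝ :=
  M.totalDemand - w n / M.price w

/-- Profit of supplier `n` at the action profile `w`. -/
noncomputable def profit (M : Market V) (w : V → ℝ) (n : V) : ℝ :=
  M.price w * M.supply w n - M.cost n (M.supply w n)

/-- `w n` is a feasible action of supplier `n` given the actions of the others: it is nonnegative,
the market clears (which needs a positive price), and the resulting supply of `n` and the
resulting line flows respect their limits. -/
def ActionFeasible (G : SimpleGraph V) [DecidableRel G.Adj] (M : Market V) (w : V → ℝ) (n : V) :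
    Prop :=
  0 ≤ w n ∧ 0 < M.price w ∧ (M.slo n ≤ M.supply w n ∧ M.supply w n ≤ M.shi n) ∧
    M.FlowOK G (M.supply w)

/-- Supply function equilibrium: every supplier's action maximizes its profit over its feasible
actions, given the actions of the others (a generalized Nash equilibrium). -/
def IsSFE (G : SimpleGraph V) [DecidableRel G.Adj] (M : Market V) (w : V → ℝ) : Prop :=
  ∀ n ∈ M.gens, M.ActionFeasible G w n ∧
    ∀ x : ℝ, M.ActionFeasible G (Function.update w n x) n →
      M.profit (Function.update w n x) n ≤ M.profit w n

/-- `ρ` is the price of anarchy: equilibria and social optima exist, and the ratio of the total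
cost at equilibrium to the total cost at social optimum is `ρ`, whichever equilibrium and optimum
are taken. -/
def IsPoA (G : SimpleGraph V) [DecidableRel G.Adj] (M : Market V) (ρ : ℝ) : Prop :=
  (∃ w, M.IsSFE G w) ∧ (∃ s, M.IsSocialOptimum G s) ∧
    ∀ w s, M.IsSFE G w → M.IsSocialOptimum G s →
      M.totalCost (M.supply w) / M.totalCost s = ρ

/-- Effective flow limit from node `n` to its neighbor `m`. -/
noncomputable def effFlow {G : SimpleGraph V} [DecidableRel G.Adj] (M : Market V)
    (P : NeighborPartition G) (n m : V) : ℝ :=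
  if (P.parts n).part m = {m} then M.f s(n, m)
  else min (M.f s(n, m))
    ((∑ e ∈ (P.cyc n ((P.parts n).part m)).erase s(n, m), M.f e / M.B e) * M.B s(n, m))

/-- The network term of supplier `n`: local demand plus effective flow limits of its lines. -/
noncomputable def networkTerm {G : SimpleGraph V} [DecidableRel G.Adj] (M : Market V)
    (P : NeighborPartition G) (n : V) : ℝ :=
  M.d n + ∑ m ∈ G.neighborFinset n, M.effFlow P n m

/-- The upper bound on the price of anarchy. -/
noncomputable def bound {G : SimpleGraph V} [DecidableRel G.Adj] (M : Market V)
    (P : NeighborPartition G) : ℝ :=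
  1 + ⨆ n : M.gens,
    min (M.shi n) (min (M.totalDemand - ∑ m ∈ M.gens.erase n, M.slo m) (M.networkTerm P n)) /
      (((M.gens.card : ℝ) - 2) * M.totalDemand)

/-- The upper bound with only its network component. -/
noncomputable def networkBound {G : SimpleGraph V} [DecidableRel G.Adj] (M : Market V)
    (P : NeighborPartition G) : ℝ :=
  1 + ⨆ n : M.gens, M.networkTerm P n / (((M.gens.card : ℝ) - 2) * M.totalDemand)

end Market

end PowerMarket

/-! At an interior optimum a supplier with marginal cost `c'` perceives the marginal cost
`c' * (1 + s / E)`, where `s` is its supply and `E = (|𝒩_g| - 2) * D`. Choose a hub, a node whose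
removal leaves the network connected, give it almost the whole demand and let its first `A` units
be almost free, where `A` falls just short of the total demand, and its further units cost `1` each.
All other suppliers have the constant marginal cost `γ` for which the perceived marginal costs
balance, so that `γ` is about `1 + A / E`. The optimum has the hub produce `A + 1` units, at a total
cost of about `1`; in every equilibrium the hub withholds the last unit, which the others produce at
the cost `γ` instead. So the price of anarchy is about `γ`, and so is the bound, as the network term
of the hub is about `A`.

The flow limits do not interfere. Because of the choice of the demands, every line of the hub is
saturated towards its other end in the optimum, and if the admittances away from the hub are large,
then the flows on the lines of the hub can only move away from that limit, all of them together. -/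

namespace PowerMarket

section Cycles

variable {V : Type*} {G : SimpleGraph V}

theorem reachable_deleteIncidenceSet_of_mem_support {n i j u v : V} {p : G.Walk u v}
    (hn : n ∉ p.support) (hi : i ∈ p.support) (hj : j ∈ p.support) :
    (G.deleteIncidenceSet n).Reachable i j := by
  classical
  have hedges : ∀ e ∈ p.edges, e ∈ (G.deleteIncidenceSet n).edgeSet := fun e he ↦ by
    rw [SimpleGraph.edgeSet_deleteIncidenceSet]
    exact ⟨p.edges_subset_edgeSet he, fun h ↦ hn (p.mem_support_of_mem_edges he h.2)⟩
  have hreach {x : V} (hx : x ∈ p.support) : (G.deleteIncidenceSet n).Reachable u x :=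
    ((p.transfer _ hedges).takeUntil x (by rwa [SimpleGraph.Walk.support_transfer])).reachable
  exact (hreach hi).symm.trans (hreach hj)

theorem notMem_support_of_walk_deleteIncidenceSet {n i j : V} (hi : i ≠ n)
    (p : (G.deleteIncidenceSet n).Walk i j) : n ∉ p.support := by
  classical
  intro hn
  have hnil : ¬ (p.takeUntil n hn).Nil := SimpleGraph.Walk.not_nil_of_ne hi
  exact (G.deleteIncidenceSet_adj.1 ((p.takeUntil n hn).adj_penultimate hnil)).2.2 rfl

theorem exists_isCycleSet_of_reachable_deleteIncidenceSet [DecidableEq V] {n i j : V}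
    (hi : G.Adj n i) (hj : G.Adj n j) (hij : i ≠ j)
    (h : (G.deleteIncidenceSet n).Reachable i j) :
    ∃ C, IsCycleSet G C ∧ s(n, i) ∈ C ∧ s(n, j) ∈ C := by
  obtain ⟨p, hp⟩ := h.exists_isPath
  have hn : n ∉ p.support := notMem_support_of_walk_deleteIncidenceSet hi.ne' p
  set q : G.Walk i j := p.mapLe (G.deleteIncidenceSet_le n) with hq
  have hnq : n ∉ q.support := by simpa [hq] using hn
  refine ⟨_, ⟨n, .cons hi (q.concat hj.symm), ?_, rfl⟩, ?_, ?_⟩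
  · rw [SimpleGraph.Walk.cons_isCycle_iff, SimpleGraph.Walk.edges_concat, List.concat_eq_append,
      List.mem_append, List.mem_singleton]
    refine ⟨(hp.mapLe _).concat hnq hj.symm, ?_⟩
    rintro (h | h)
    · exact hnq (q.fst_mem_support_of_mem_edges h)
    · rcases Sym2.eq_iff.1 h with ⟨h, -⟩ | ⟨-, h⟩
      exacts [hj.ne h, hij h]
  · simp
  · simp [SimpleGraph.Walk.edges_concat, Sym2.eq_swap]

theorem reachable_deleteIncidenceSet_of_isCycle {n i j u : V} {p : G.Walk u u} (hp : p.IsCycle)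
    (hi : i ∈ p.support) (hj : j ∈ p.support) (hin : i ≠ n) (hjn : j ≠ n) :
    (G.deleteIncidenceSet n).Reachable i j := by
  classical
  by_cases hn : n ∈ p.support
  · set c := p.rotate n hn
    have hc : c.IsCycle := hp.rotate hn
    have htail : ¬ c.tail.Nil := by
      rw [← SimpleGraph.Walk.length_eq_zero_iff.not]
      have := c.length_tail_add_one hc.not_nil
      have := hc.three_le_length
      omega
    have hsupport : c.support = n :: (c.tail.dropLast.support ++ [n]) := by
      rw [SimpleGraph.Walk.support_dropLast htail, SimpleGraph.Walk.dropLast_support_concat,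
        SimpleGraph.Walk.cons_support_tail hc.not_nil]
    have hnotMem : n ∉ c.tail.dropLast.support := by
      have hnodup := hc.support_nodup
      rw [hsupport, List.tail_cons, List.nodup_append] at hnodup
      exact fun h ↦ hnodup.2.2 n h n (List.mem_singleton_self n) rfl
    have mem_support {x : V} (hx : x ∈ p.support) (hxn : x ≠ n) :
        x ∈ c.tail.dropLast.support := by
      have : x ∈ c.support := (p.mem_support_rotate_iff n hn).2 hx
      simpa [hsupport, hxn] using this
    exact reachable_deleteIncidenceSet_of_mem_support hnotMem (mem_support hi hin)
      (mem_support hj hjn)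
  · exact reachable_deleteIncidenceSet_of_mem_support hn hi hj

theorem IsCycleSet.eq_or_eq [DecidableEq V] {C : Finset (Sym2 V)} (hC : IsCycleSet G C)
    {n i j k : V} (hi : s(n, i) ∈ C) (hj : s(n, j) ∈ C) (hk : s(n, k) ∈ C) (hij : i ≠ j) :
    k = i ∨ k = j := by
  obtain ⟨u, p, hp, rfl⟩ := hC
  simp only [List.mem_toFinset] at hi hj hk
  have htwo := hp.ncard_neighborSet_toSubgraph_eq_two (p.fst_mem_support_of_mem_edges hi)
  by_contra! hne
  have hsub : ({i, j, k} : Set V) ⊆ p.toSubgraph.neighborSet n := by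
    rintro x (rfl | rfl | rfl) <;>
      simpa only [SimpleGraph.Subgraph.mem_neighborSet,
        SimpleGraph.Walk.adj_toSubgraph_iff_mem_edges]
  have hthree : ({i, j, k} : Set V).ncard = 3 :=
    Set.ncard_eq_three.2 ⟨i, j, k, hij, hne.1.symm, hne.2.symm, rfl⟩
  have := Set.ncard_le_ncard hsub (Set.finite_of_ncard_ne_zero (by omega))
  omega

variable [Fintype V] [DecidableEq V] [DecidableRel G.Adj]

open Classical in
/-- The partition of the neighbors of `n` into the sets that stay connected when `n` is removed
from the network. -/
noncomputable def neighborComponents (G : SimpleGraph V) [DecidableRel G.Adj] (n : V) :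
    Finpartition (G.neighborFinset n) :=
  Finpartition.ofSetSetoid (G.deleteIncidenceSet n).reachableSetoid (G.neighborFinset n)

theorem adj_of_mem_neighborComponents {n i : V} {S : Finset V}
    (hS : S ∈ (neighborComponents G n).parts) (hi : i ∈ S) : G.Adj n i :=
  (G.mem_neighborFinset n i).1 ((neighborComponents G n).subset hS hi)

theorem mem_neighborComponents_iff {n i j : V} {S : Finset V}
    (hS : S ∈ (neighborComponents G n).parts) (hi : i ∈ S) (hj : G.Adj n j) :
    j ∈ S ↔ (G.deleteIncidenceSet n).Reachable i j := by
  classical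
  have hni := adj_of_mem_neighborComponents hS hi
  rw [← (neighborComponents G n).part_eq_of_mem hS hi, neighborComponents,
    Finpartition.mem_part_ofSetSetoid_iff_rel]
  simp only [SimpleGraph.mem_neighborFinset, hni, hj, true_and]
  rfl

theorem exists_isCycleSet_of_mem_neighborComponents {n i j : V} {S : Finset V}
    (hS : S ∈ (neighborComponents G n).parts) (hi : i ∈ S) (hj : j ∈ S) (hij : i ≠ j) :
    ∃ C, IsCycleSet G C ∧ s(n, i) ∈ C ∧ s(n, j) ∈ C := by
  have hnj := adj_of_mem_neighborComponents hS hj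
  exact exists_isCycleSet_of_reachable_deleteIncidenceSet (adj_of_mem_neighborComponents hS hi)
    hnj hij ((mem_neighborComponents_iff hS hi hnj).1 hj)

theorem not_isCycleSet_of_singleton_mem_neighborComponents {n i j : V} (hij : i ≠ j)
    (hi : {i} ∈ (neighborComponents G n).parts) (hj : G.Adj n j) :
    ¬ ∃ C, IsCycleSet G C ∧ (∃ e ∈ C, i ∈ e) ∧ (∃ e ∈ C, j ∈ e) := by
  rintro ⟨_, ⟨u, p, hp, rfl⟩, ⟨e, he, hie⟩, ⟨e', he', hje'⟩⟩
  have hmem := Finset.mem_singleton_self i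
  have hreach : (G.deleteIncidenceSet n).Reachable i j :=
    reachable_deleteIncidenceSet_of_isCycle hp
      (p.mem_support_of_mem_edges (List.mem_toFinset.1 he) hie)
      (p.mem_support_of_mem_edges (List.mem_toFinset.1 he') hje')
      (adj_of_mem_neighborComponents hi hmem).ne' hj.ne'
  exact hij (Finset.mem_singleton.1 ((mem_neighborComponents_iff hi hmem hj).2 hreach)).symm

namespace IsWeaklyCyclic

theorem card_neighborComponents (hG : IsWeaklyCyclic G) {n : V} {S : Finset V}
    (hS : S ∈ (neighborComponents G n).parts) : S.card = 1 ∨ S.card = 2 := by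
  have hpos : 0 < S.card := Finset.card_pos.2 ((neighborComponents G n).nonempty_of_mem_parts hS)
  suffices ¬ 2 < S.card by omega
  intro hlt
  obtain ⟨i, hi, j, hj, k, hk, hij, hik, hjk⟩ := Finset.two_lt_card.1 hlt
  obtain ⟨C, hC, hCi, hCj⟩ := exists_isCycleSet_of_mem_neighborComponents hS hi hj hij
  obtain ⟨C', hC', hCi', hCk'⟩ := exists_isCycleSet_of_mem_neighborComponents hS hi hk hik
  obtain rfl := hG C C' hC hC' _ hCi hCi'
  rcases hC.eq_or_eq hCi hCj hCk' hij with h | h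
  exacts [hik h.symm, hjk h.symm]

theorem nonempty_neighborPartition (hG : IsWeaklyCyclic G) : Nonempty (NeighborPartition G) := by
  have hex (n : V) (S : Finset V) : ∃ C, S ∈ (neighborComponents G n).parts → S.card = 2 →
      IsCycleSet G C ∧ ∀ i ∈ S, s(n, i) ∈ C := by
    by_cases h : S ∈ (neighborComponents G n).parts ∧ S.card = 2
    · obtain ⟨hS, htwo⟩ := h
      obtain ⟨i, j, hij, rfl⟩ := Finset.card_eq_two.1 htwo
      obtain ⟨C, hC, hi, hj⟩ :=
        exists_isCycleSet_of_mem_neighborComponents hS (i := i) (j := j) (by simp) (by simp) hij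
      exact ⟨C, fun _ _ ↦ ⟨hC, by simp [hi, hj]⟩⟩
    · exact ⟨∅, fun hS htwo ↦ absurd ⟨hS, htwo⟩ h⟩
  choose cyc hcyc using hex
  exact ⟨{
    parts := neighborComponents G
    cyc := cyc
    card_part := fun n S hS ↦ hG.card_neighborComponents hS
    isCycleSet_cyc := fun n S hS htwo ↦ (hcyc n S hS htwo).1
    mem_cyc := fun n S hS htwo ↦ (hcyc n S hS htwo).2
    singletons := fun n i j hij hi hj ↦ not_isCycleSet_of_singleton_mem_neighborComponents hij hi
      (adj_of_mem_neighborComponents hj (Finset.mem_singleton_self j)) }⟩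

end IsWeaklyCyclic

end Cycles

section Flows

variable {V : Type*} (G : SimpleGraph V) (B : Sym2 V → ℝ)

/-- The flow from `i` to `j` that the voltage angles `θ` induce on a line of admittance
`B s(i, j)`. -/
def lineFlow (θ : V → ℝ) (i j : V) : ℝ := B s(i, j) * (θ i - θ j)

/-- The net outflow of every node as a function of the voltage angles: the Laplacian of the
network weighted by the admittances. -/
def netOutflow [Fintype V] [DecidableRel G.Adj] : (V → ℝ) →ₗ[ℝ] (V → ℝ) where
  toFun θ i := ∑ j ∈ G.neighborFinset i, lineFlow B θ i j
  map_add' θ η := by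
    ext i
    simp only [lineFlow, Pi.add_apply, ← Finset.sum_add_distrib]
    exact Finset.sum_congr rfl fun j _ ↦ by ring
  map_smul' a θ := by
    ext i
    simp only [lineFlow, Pi.smul_apply, smul_eq_mul, RingHom.id_apply, Finset.mul_sum]
    exact Finset.sum_congr rfl fun j _ ↦ by ring

variable {G B}

theorem lineFlow_swap (θ : V → ℝ) (i j : V) : lineFlow B θ j i = -lineFlow B θ i j := by
  rw [lineFlow, lineFlow, Sym2.eq_swap]
  ring

theorem lineFlow_add_smul (θ φ : V → ℝ) (τ : ℝ) (i j : V) :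
    lineFlow B (θ + τ • φ) i j = lineFlow B θ i j + τ * lineFlow B φ i j := by
  simp only [lineFlow, Pi.add_apply, Pi.smul_apply, smul_eq_mul]
  ring

theorem abs_sub_le_card_mul_of_reachable [Fintype V] {θ : V → ℝ} {δ : ℝ} (hδ : 0 ≤ δ)
    (hadj : ∀ i j, G.Adj i j → |θ i - θ j| ≤ δ) {i j : V} (hij : G.Reachable i j) :
    |θ i - θ j| ≤ Fintype.card V * δ := by
  have hwalk {i j : V} (p : G.Walk i j) : |θ i - θ j| ≤ p.length * δ := by
    induction p with
    | nil => simp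
    | @cons i k j h p ih =>
      calc |θ i - θ j| ≤ |θ i - θ k| + |θ k - θ j| := abs_sub_le _ _ _
        _ ≤ δ + p.length * δ := add_le_add (hadj i k h) ih
        _ = (p.cons h).length * δ := by rw [SimpleGraph.Walk.length_cons]; push_cast; ring
  obtain ⟨p, hp⟩ := hij.exists_isPath
  have hlength : (p.length : ℝ) ≤ Fintype.card V := by exact_mod_cast hp.length_lt.le
  exact (hwalk p).trans (mul_le_mul_of_nonneg_right hlength hδ)

variable [Fintype V] [DecidableRel G.Adj]

variable (G) in
theorem degree_add_one_le_card (v : V) : (G.degree v : ℝ) + 1 ≤ Fintype.card V := by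
  exact_mod_cast G.degree_lt_card_verts v

theorem netOutflow_apply (θ : V → ℝ) (i : V) :
    netOutflow G B θ i = ∑ j ∈ G.neighborFinset i, lineFlow B θ i j := rfl

theorem sum_netOutflow_eq_sum_boundary [DecidableEq V] (θ : V → ℝ) (U : Finset V) :
    ∑ i ∈ U, netOutflow G B θ i = ∑ i ∈ U, ∑ j ∈ G.neighborFinset i \ U, lineFlow B θ i j := by
  have hcancel : ∑ i ∈ U, ∑ j ∈ G.neighborFinset i ∩ U, lineFlow B θ i j = 0 := by
    refine eq_zero_of_neg_eq (Eq.symm ?_)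
    simp only [← Finset.sum_neg_distrib, ← lineFlow_swap]
    refine Finset.sum_comm' fun i j ↦ ?_
    simp only [Finset.mem_inter, SimpleGraph.mem_neighborFinset, G.adj_comm i j]
    tauto
  rw [← add_zero (∑ i ∈ U, ∑ j ∈ _ \ U, _), ← hcancel, ← Finset.sum_add_distrib]
  refine Finset.sum_congr rfl fun i _ ↦ ?_
  rw [netOutflow_apply, add_comm, Finset.sum_inter_add_sum_sdiff]

theorem sum_netOutflow (θ : V → ℝ) : ∑ i, netOutflow G B θ i = 0 := by
  classical
  simp [sum_netOutflow_eq_sum_boundary, Finset.sdiff_eq_empty_iff_subset.2]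

theorem lineFlow_le_sum_posPart (hB : ∀ e ∈ G.edgeSet, 0 ≤ B e) (θ : V → ℝ) {i j : V}
    (hij : G.Adj i j) : lineFlow B θ i j ≤ ∑ l, (netOutflow G B θ l)⁺ := by
  classical
  rcases le_or_gt (θ i) (θ j) with h | h
  · exact (mul_nonpos_of_nonneg_of_nonpos (hB _ hij) (sub_nonpos.2 h)).trans
      (Finset.sum_nonneg fun _ _ ↦ posPart_nonneg _)
  -- Across the boundary of `U` all flow is outward, and `s(i, j)` is one of the boundary lines.
  let U : Finset V := {l | θ i ≤ θ l}
  have hi : i ∈ U := by simp [U]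
  have hj : j ∈ G.neighborFinset i \ U := by simp [U, hij, h]
  have hnonneg : ∀ a ∈ U, ∀ b ∈ G.neighborFinset a \ U, 0 ≤ lineFlow B θ a b := by
    intro a ha b hb
    simp only [U, Finset.mem_sdiff, SimpleGraph.mem_neighborFinset, Finset.mem_filter,
      Finset.mem_univ, true_and, not_le] at ha hb
    exact mul_nonneg (hB _ hb.1) (by linarith)
  calc lineFlow B θ i j
      ≤ ∑ b ∈ G.neighborFinset i \ U, lineFlow B θ i b :=
        Finset.single_le_sum (f := lineFlow B θ i) (hnonneg i hi) hj
    _ ≤ ∑ a ∈ U, ∑ b ∈ G.neighborFinset a \ U, lineFlow B θ a b :=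
        Finset.single_le_sum (f := fun a ↦ ∑ b ∈ G.neighborFinset a \ U, lineFlow B θ a b)
          (fun a ha ↦ Finset.sum_nonneg (hnonneg a ha)) hi
    _ = ∑ l ∈ U, netOutflow G B θ l := (sum_netOutflow_eq_sum_boundary θ U).symm
    _ ≤ ∑ l ∈ U, (netOutflow G B θ l)⁺ := Finset.sum_le_sum fun l _ ↦ le_posPart _
    _ ≤ ∑ l, (netOutflow G B θ l)⁺ :=
        Finset.sum_le_univ_sum_of_nonneg fun _ ↦ posPart_nonneg _

theorem abs_lineFlow_le_sum_posPart (hB : ∀ e ∈ G.edgeSet, 0 ≤ B e) (θ : V → ℝ) {i j : V}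
    (hij : G.Adj i j) : |lineFlow B θ i j| ≤ ∑ l, (netOutflow G B θ l)⁺ := by
  refine abs_le'.2 ⟨lineFlow_le_sum_posPart hB θ hij, ?_⟩
  rw [← lineFlow_swap]
  exact lineFlow_le_sum_posPart hB θ hij.symm

theorem sum_posPart_netOutflow {v : V} {θ : V → ℝ} (hθ : ∀ i, i ≠ v → 0 ≤ netOutflow G B θ i) :
    ∑ i, (netOutflow G B θ i)⁺ = -netOutflow G B θ v := by
  classical
  have hrest : 0 ≤ ∑ i ∈ Finset.univ.erase v, netOutflow G B θ i :=
    Finset.sum_nonneg fun i hi ↦ hθ i (Finset.ne_of_mem_erase hi)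
  have hsum := sum_netOutflow (G := G) (B := B) θ
  rw [← Finset.add_sum_erase _ _ (Finset.mem_univ v)] at hsum ⊢
  rw [posPart_eq_zero.2 (by linarith), zero_add, Finset.sum_congr rfl fun i hi ↦
    posPart_of_nonneg (hθ i (Finset.ne_of_mem_erase hi))]
  linarith

theorem eq_of_netOutflow_eq_zero (hG : G.Preconnected) (hB : ∀ e ∈ G.edgeSet, 0 < B e) {θ : V → ℝ}
    (hθ : netOutflow G B θ = 0) (i j : V) : θ i = θ j := by
  have hadj (i j : V) (hij : G.Adj i j) : |θ i - θ j| ≤ 0 := by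
    have hflow := abs_lineFlow_le_sum_posPart (fun e he ↦ (hB e he).le) θ hij
    simp only [lineFlow, hθ, abs_mul, abs_of_pos (hB s(i, j) hij), Pi.zero_apply, posPart_zero,
      Finset.sum_const_zero] at hflow
    exact nonpos_of_mul_nonpos_right hflow (hB s(i, j) hij)
  have h := abs_sub_le_card_mul_of_reachable le_rfl hadj (hG i j)
  rwa [mul_zero, abs_nonpos_iff, sub_eq_zero] at h

theorem exists_netOutflow_eq (hG : G.Connected) (hB : ∀ e ∈ G.edgeSet, 0 < B e) {y : V → ℝ}
    (hy : ∑ i, y i = 0) : ∃ θ, netOutflow G B θ = y := by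
  obtain ⟨i₀⟩ := hG.nonempty
  let total : Module.Dual ℝ (V → ℝ) := Fintype.linearCombination ℝ (1 : V → ℝ)
  have htotal (z : V → ℝ) : total z = ∑ i, z i := by
    simp [total, Fintype.linearCombination_apply]
  have htotal_ne : total ≠ 0 := by
    classical
    intro h
    simpa [htotal] using DFunLike.congr_fun h (Pi.single i₀ 1)
  have hrange : LinearMap.range (netOutflow G B) ≤ LinearMap.ker total := by
    rintro _ ⟨θ, rfl⟩
    rw [LinearMap.mem_ker, htotal, sum_netOutflow]
  have hker : LinearMap.ker (netOutflow G B) ≤ Submodule.span ℝ {1} := fun θ hθ ↦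
    Submodule.mem_span_singleton.2 ⟨θ i₀, funext fun i ↦ by
      simp [eq_of_netOutflow_eq_zero hG.preconnected hB (LinearMap.mem_ker.1 hθ) i₀ i]⟩
  have hone : (1 : V → ℝ) ≠ 0 := fun h ↦ one_ne_zero (congrFun h i₀)
  have hfinrank : Module.finrank ℝ (LinearMap.ker total) ≤
      Module.finrank ℝ (LinearMap.range (netOutflow G B)) := by
    have hker_le := (Submodule.finrank_mono hker).trans_eq (finrank_span_singleton hone)
    have hrank := (netOutflow G B).finrank_range_add_finrank_ker
    have := Module.Dual.finrank_ker_add_one_of_ne_zero htotal_ne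
    omega
  have hmem : y ∈ LinearMap.ker total := by rw [LinearMap.mem_ker, htotal, hy]
  rwa [← Submodule.eq_of_le_of_finrank_le hrange hfinrank] at hmem

end Flows

section HubFlows

variable {V : Type*} [DecidableEq V]

/-- Admittances that concentrate the resistance of the network at the lines of one node, the hub
`v`: they are `1` there and `b` elsewhere, where `b` is going to be large. -/
def hubAdmittance (v : V) (b : ℝ) (e : Sym2 V) : ℝ := if v ∈ e then 1 else b

theorem hubAdmittance_pos {v : V} {b : ℝ} (hb : 0 < b) (e : Sym2 V) : 0 < hubAdmittance v b e := by
  rw [hubAdmittance]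
  split_ifs
  exacts [one_pos, hb]

theorem lineFlow_hubAdmittance {v : V} {b : ℝ} (θ : V → ℝ) (j : V) :
    lineFlow (hubAdmittance v b) θ v j = θ v - θ j := by
  simp [lineFlow, hubAdmittance]

variable [Fintype V] {G : SimpleGraph V} [DecidableRel G.Adj]

theorem abs_sub_le_of_reachable_deleteIncidenceSet {v : V} {b : ℝ} (hb : 0 < b) (θ : V → ℝ)
    {i j : V} (hij : (G.deleteIncidenceSet v).Reachable i j) :
    |θ i - θ j| ≤
      Fintype.card V * ((∑ l, (netOutflow G (hubAdmittance v b) θ l)⁺) / b) := by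
  refine abs_sub_le_card_mul_of_reachable
    (div_nonneg (Finset.sum_nonneg fun _ _ ↦ posPart_nonneg _) hb.le) (fun k l hkl ↦ ?_) hij
  obtain ⟨hkl, hk, hl⟩ := G.deleteIncidenceSet_adj.1 hkl
  have hflow := abs_lineFlow_le_sum_posPart (fun e _ ↦ (hubAdmittance_pos (v := v) hb e).le) θ hkl
  rw [lineFlow, hubAdmittance, if_neg (by simp [hk.symm, hl.symm]), abs_mul, abs_of_pos hb] at hflow
  rwa [le_div_iff₀' hb]

/-- Large admittances off the hub nearly equalize the angles there, so the hub lines share the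
hub's injection almost evenly and, in particular, have the same direction. -/
theorem lineFlow_hub_neg {v : V} {b : ℝ}
    (hv : ∀ i j, i ≠ v → j ≠ v → (G.deleteIncidenceSet v).Reachable i j) (hb : 0 < b)
    {θ : V → ℝ}
    (hθ : (Fintype.card V : ℝ) ^ 2 * ((∑ l, (netOutflow G (hubAdmittance v b) θ l)⁺) / b) <
      -netOutflow G (hubAdmittance v b) θ v) {j : V} (hj : G.Adj v j) :
    lineFlow (hubAdmittance v b) θ v j < 0 := by
  set δ := (∑ l, (netOutflow G (hubAdmittance v b) θ l)⁺) / b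
  have hδ : 0 ≤ δ := div_nonneg (Finset.sum_nonneg fun _ _ ↦ posPart_nonneg _) hb.le
  have hdegree : (G.degree v : ℝ) ≤ Fintype.card V := by linarith [degree_add_one_le_card G v]
  rw [lineFlow_hubAdmittance]
  by_contra! hnonneg
  have hflow : ∀ k ∈ G.neighborFinset v,
      -(Fintype.card V * δ) ≤ lineFlow (hubAdmittance v b) θ v k := by
    intro k hk
    have hreach := hv j k hj.ne' ((G.mem_neighborFinset v k).1 hk).ne'
    rw [lineFlow_hubAdmittance]
    linarith [(abs_le.1 (abs_sub_le_of_reachable_deleteIncidenceSet hb θ hreach)).1]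
  have hsum := Finset.card_nsmul_le_sum _ _ _ hflow
  rw [SimpleGraph.card_neighborFinset_eq_degree, nsmul_eq_mul, ← netOutflow_apply] at hsum
  nlinarith [mul_le_mul_of_nonneg_right hdegree (mul_nonneg (Nat.cast_nonneg' (Fintype.card V)) hδ)]

theorem netOutflow_hubAdmittance_single_self (v : V) (b : ℝ) :
    netOutflow G (hubAdmittance v b) (Pi.single v 1) v = G.degree v := by
  rw [netOutflow_apply, ← G.card_neighborFinset_eq_degree, Finset.card_eq_sum_ones, Nat.cast_sum]
  refine Finset.sum_congr rfl fun j hj ↦ ?_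
  have hj : j ≠ v := ((G.mem_neighborFinset v j).1 hj).ne'
  rw [lineFlow_hubAdmittance, Pi.single_eq_same, Pi.single_eq_of_ne hj, sub_zero, Nat.cast_one]

theorem netOutflow_hubAdmittance_single_of_ne {v i : V} (b : ℝ) (hi : i ≠ v) :
    netOutflow G (hubAdmittance v b) (Pi.single v 1) i = if G.Adj i v then -1 else 0 := by
  simp only [netOutflow_apply, ← G.mem_neighborFinset i v]
  rw [← Finset.sum_ite_eq' (G.neighborFinset i) v fun _ ↦ (-1 : ℝ)]
  refine Finset.sum_congr rfl fun j _ ↦ ?_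
  rcases eq_or_ne j v with rfl | hj
  · rw [lineFlow_swap, lineFlow_hubAdmittance]
    simp [hi]
  · simp [lineFlow, hi, hj]

end HubFlows

section CostFunction

/-- A cost function with marginal cost `(s / A) ^ k` on `[0, A]` and `1` on `[A, ∞)`: for large
`k` the first `A` units are almost free. -/
noncomputable def hockeyCost (A : ℝ) (k : ℕ) (s : ℝ) : ℝ :=
  ∫ u in (0 : ℝ)..s, (max 0 (min 1 (u / A))) ^ k

variable {A : ℝ} {k : ℕ}

theorem hockeyCost_zero : hockeyCost A k 0 = 0 := intervalIntegral.integral_same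

theorem hasDerivAt_hockeyCost (s : ℝ) :
    HasDerivAt (hockeyCost A k) ((max 0 (min 1 (s / A))) ^ k) s := by
  have hc : Continuous fun u : ℝ ↦ (max 0 (min 1 (u / A))) ^ k := by fun_prop
  exact intervalIntegral.integral_hasDerivAt_right (hc.intervalIntegrable _ _)
    (hc.stronglyMeasurableAtFilter _ _) hc.continuousAt

theorem hasDerivAt_hockeyCost_of_le (hA : 0 < A) {s : ℝ} (hs : A ≤ s) :
    HasDerivAt (hockeyCost A k) 1 s := by
  have h := hasDerivAt_hockeyCost (A := A) (k := k) s
  rwa [min_eq_left ((one_le_div hA).2 hs), max_eq_right zero_le_one, one_pow] at h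

theorem convexOn_hockeyCost (hA : 0 ≤ A) : ConvexOn ℝ Set.univ (hockeyCost A k) := by
  refine Monotone.convexOn_univ_of_deriv
    (fun s ↦ (hasDerivAt_hockeyCost s).differentiableAt) fun s t hst ↦ ?_
  rw [(hasDerivAt_hockeyCost s).deriv, (hasDerivAt_hockeyCost t).deriv]
  gcongr

theorem strictMonoOn_hockeyCost (hA : 0 < A) : StrictMonoOn (hockeyCost A k) (Set.Ici 0) := by
  refine strictMonoOn_of_deriv_pos (convex_Ici 0)
    (fun s _ ↦ (hasDerivAt_hockeyCost s).continuousAt.continuousWithinAt) fun s hs ↦ ?_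
  rw [interior_Ici, Set.mem_Ioi] at hs
  rw [(hasDerivAt_hockeyCost s).deriv]
  exact pow_pos (lt_max_of_lt_right (lt_min one_pos (div_pos hs hA))) k

theorem hockeyCost_self (hA : 0 < A) : hockeyCost A k A = A / (k + 1) := by
  have hint : hockeyCost A k A = ∫ u in (0 : ℝ)..A, (u / A) ^ k := by
    refine intervalIntegral.integral_congr fun u hu ↦ ?_
    rw [Set.uIcc_of_le hA.le] at hu
    simp only [min_eq_right ((div_le_one hA).2 hu.2), max_eq_right (div_nonneg hu.1 hA.le)]
  rw [hint, intervalIntegral.integral_comp_div (fun x ↦ x ^ k) hA.ne', integral_pow]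
  simp [hA.ne']
  ring

theorem hockeyCost_of_le (hA : 0 < A) {s : ℝ} (hs : A ≤ s) :
    hockeyCost A k s = A / (k + 1) + (s - A) := by
  have hderiv : ∀ u ∈ Set.uIcc A s, HasDerivAt (hockeyCost A k) 1 u := fun u hu ↦
    hasDerivAt_hockeyCost_of_le hA (Set.uIcc_of_le hs ▸ hu).1
  have h := intervalIntegral.integral_eq_sub_of_hasDerivAt hderiv intervalIntegrable_const
  rw [intervalIntegral.integral_const, hockeyCost_self hA] at h
  simp only [smul_eq_mul, mul_one] at h
  linarith

end CostFunction

section FirstOrderConditions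

open Filter Topology

theorem nonneg_of_hasDerivAt_of_eventually_le {g : ℝ → ℝ} {g' a : ℝ} (hg : HasDerivAt g g' a)
    (h : ∀ᶠ x in 𝓝[>] a, g a ≤ g x) : 0 ≤ g' := by
  have hslope := (hasDerivWithinAt_iff_tendsto_slope' Set.self_notMem_Ioi).1 hg.hasDerivWithinAt
  refine ge_of_tendsto hslope ?_
  filter_upwards [h, self_mem_nhdsWithin] with x hx hax
  rw [slope_def_field]
  exact div_nonneg (sub_nonneg.2 hx) (sub_nonneg.2 hax.le)

theorem nonpos_of_hasDerivAt_of_eventually_le {g : ℝ → ℝ} {g' a : ℝ} (hg : HasDerivAt g g' a)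
    (h : ∀ᶠ x in 𝓝[<] a, g a ≤ g x) : g' ≤ 0 := by
  have hslope := (hasDerivWithinAt_iff_tendsto_slope' Set.self_notMem_Iio).1 hg.hasDerivWithinAt
  refine le_of_tendsto hslope ?_
  filter_upwards [h, self_mem_nhdsWithin] with x hx hxa
  rw [slope_def_field]
  exact div_nonpos_of_nonneg_of_nonpos (sub_nonneg.2 hx) (sub_nonpos.2 hxa.le)

theorem hasDerivAt_deviation_loss {c : ℝ → ℝ} {c' a b s : ℝ} (hc : HasDerivAt c c' s) :
    HasDerivAt (fun τ ↦ c (s + τ * b) - a * (τ / (1 + τ))) (c' * b - a) 0 := by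
  have hinner : HasDerivAt (fun τ : ℝ ↦ s + τ * b) b 0 := by
    simpa using ((hasDerivAt_id' (0 : ℝ)).mul_const b).const_add s
  have hquot : HasDerivAt (fun τ : ℝ ↦ τ / (1 + τ)) 1 0 := by
    simpa using (hasDerivAt_id' (0 : ℝ)).fun_div ((hasDerivAt_id' (0 : ℝ)).const_add 1) (by simp)
  have hcomp : HasDerivAt (fun τ ↦ c (s + τ * b)) (c' * b) 0 :=
    HasDerivAt.comp (0 : ℝ) (by simpa using hc) hinner
  simpa using hcomp.fun_sub (hquot.const_mul a)

end FirstOrderConditions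

namespace Market

open Filter Topology

variable {V : Type*} [Fintype V]

/-- The quantity `E = (|𝒩_g| - 2) * D`. Given the actions of its rivals, the price of a supplier
producing `s` is inversely proportional to `E + s`; so it perceives the marginal cost
`c' * (1 + s / E)`. -/
def markupScale (M : Market V) : ℝ := ((M.gens.card : ℝ) - 2) * M.totalDemand

section Price

variable {M : Market V} {w : V → ℝ}

theorem sum_action_eq (hp : M.price w ≠ 0) :
    ∑ n ∈ M.gens, w n = ((M.gens.card : ℝ) - 1) * M.totalDemand * M.price w := by
  have hne : ((M.gens.card : ℝ) - 1) * M.totalDemand ≠ 0 := fun h ↦ hp (by rw [price, h, div_zero])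
  rw [price, mul_div_cancel₀ _ hne]

theorem price_mul_totalDemand_sub_supply (hp : M.price w ≠ 0) (n : V) :
    M.price w * (M.totalDemand - M.supply w n) = w n := by
  rw [supply, sub_sub_cancel, mul_div_cancel₀ _ hp]

theorem sum_supply (hp : M.price w ≠ 0) : ∑ n ∈ M.gens, M.supply w n = M.totalDemand := by
  simp only [supply, Finset.sum_sub_distrib, Finset.sum_const, ← Finset.sum_div,
    sum_action_eq hp, mul_div_cancel_right₀ _ hp, nsmul_eq_mul]
  ring

end Price

variable [DecidableEq V] {G : SimpleGraph V} [DecidableRel G.Adj] {M : Market V} {w : V → ℝ}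
  {m : V}

section Deviation

/-- The direction in which the supply profile `s` moves when supplier `m` alone changes its action:
dividing the price by `1 + τ` moves the profile by `τ` times this vector. -/
def deviation (M : Market V) (s : V → ℝ) (m : V) : V → ℝ := fun i ↦
  if i = m then M.markupScale + s m else s i - M.totalDemand

theorem deviation_self (M : Market V) (s : V → ℝ) (m : V) :
    M.deviation s m m = M.markupScale + s m := if_pos rfl

theorem deviation_of_ne (M : Market V) (s : V → ℝ) {i m : V} (hi : i ≠ m) :
    M.deviation s m i = s i - M.totalDemand := if_neg hi

theorem sum_deviation {s : V → ℝ} (hm : m ∈ M.gens) (hs : ∑ n ∈ M.gens, s n = M.totalDemand) :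
    ∑ n ∈ M.gens, M.deviation s m n = 0 := by
  have hrest : ∑ n ∈ M.gens.erase m, M.deviation s m n =
      ∑ n ∈ M.gens.erase m, (s n - M.totalDemand) :=
    Finset.sum_congr rfl fun n hn ↦ M.deviation_of_ne s (Finset.ne_of_mem_erase hn)
  have htotal := Finset.add_sum_erase _ (fun n ↦ s n - M.totalDemand) hm
  rw [Finset.sum_sub_distrib (s := M.gens), hs, Finset.sum_const, nsmul_eq_mul] at htotal
  rw [← Finset.add_sum_erase _ _ hm, hrest, deviation_self, markupScale]
  linarith

theorem price_mul_markupScale_add_supply (hm : m ∈ M.gens) (hp : M.price w ≠ 0) :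
    M.price w * (M.markupScale + M.supply w m) = ∑ n ∈ M.gens.erase m, w n := by
  have hsum := Finset.add_sum_erase _ w hm
  rw [sum_action_eq hp, ← price_mul_totalDemand_sub_supply hp m] at hsum
  rw [markupScale]
  linarith

theorem profit_eq (hm : m ∈ M.gens) (hp : M.price w ≠ 0) :
    M.profit w m =
      ∑ n ∈ M.gens.erase m, w n - M.price w * M.markupScale - M.cost m (M.supply w m) := by
  rw [profit, ← price_mul_markupScale_add_supply hm hp]
  ring

theorem supply_update {x : ℝ} (hm : m ∈ M.gens) (hp : M.price w ≠ 0)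
    (hq : M.price (Function.update w m x) ≠ 0) :
    M.supply (Function.update w m x) = M.supply w +
      (M.price w / M.price (Function.update w m x) - 1) • M.deviation (M.supply w) m := by
  have hself : M.price (Function.update w m x) *
      (M.markupScale + M.supply (Function.update w m x) m) =
        M.price w * (M.markupScale + M.supply w m) := by
    rw [price_mul_markupScale_add_supply hm hq, price_mul_markupScale_add_supply hm hp,
      Finset.sum_update_of_notMem (Finset.notMem_erase m _)]
  ext i
  simp only [Pi.add_apply, Pi.smul_apply, smul_eq_mul]
  rcases eq_or_ne i m with rfl | hi
  · rw [deviation_self]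
    field_simp
    linarith
  · have hother := price_mul_totalDemand_sub_supply hq i
    rw [Function.update_of_ne hi, ← price_mul_totalDemand_sub_supply hp i] at hother
    rw [deviation_of_ne M _ hi]
    field_simp
    linarith

theorem exists_price_update_eq (hM : M.IsAdmissible G) (w : V → ℝ) (hm : m ∈ M.gens) (q : ℝ) :
    ∃ x, M.price (Function.update w m x) = q := by
  refine ⟨q * (((M.gens.card : ℝ) - 1) * M.totalDemand) - ∑ n ∈ M.gens.erase m, w n, ?_⟩
  have hcard : (2 : ℝ) < M.gens.card := by exact_mod_cast hM.two_lt_card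
  have hne : ((M.gens.card : ℝ) - 1) * M.totalDemand ≠ 0 :=
    (mul_pos (by linarith) hM.totalDemand_pos).ne'
  rw [price, ← Finset.add_sum_erase _ _ hm,
    Finset.sum_update_of_notMem (Finset.notMem_erase m _), Function.update_self, sub_add_cancel,
    mul_div_cancel_right₀ _ hne]

end Deviation

section Equilibrium

theorem IsAdmissible.markupScale_pos (hM : M.IsAdmissible G) : 0 < M.markupScale := by
  have hcard : (2 : ℝ) < M.gens.card := by exact_mod_cast hM.two_lt_card
  exact mul_pos (by linarith) hM.totalDemand_pos

theorem IsFeasible.le_totalDemand (hM : M.IsAdmissible G) {s : V → ℝ} (hs : M.IsFeasible G s)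
    (hm : m ∈ M.gens) : s m ≤ M.totalDemand := by
  rw [← hs.1]
  exact Finset.single_le_sum (fun n hn ↦ (hM.slo_nonneg n hn).trans (hs.2.1 n hn).1) hm

/-- Supplier `m` has an action that leads to the supply profile `s`, if the profile is one that
`m` can induce at all. The condition `s m ≤ M.totalDemand` expresses that actions are
nonnegative. -/
def IsAttainable (G : SimpleGraph V) [DecidableRel G.Adj] (M : Market V) (s : V → ℝ) (m : V) :
    Prop :=
  (M.slo m ≤ s m ∧ s m ≤ M.shi m) ∧ s m ≤ M.totalDemand ∧ M.FlowOK G s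

theorem IsFeasible.isAttainable (hM : M.IsAdmissible G) {s : V → ℝ} (hs : M.IsFeasible G s)
    (hm : m ∈ M.gens) : M.IsAttainable G s m :=
  ⟨hs.2.1 m hm, hs.le_totalDemand hM hm, hs.2.2⟩

theorem actionFeasible_iff :
    M.ActionFeasible G w m ↔ 0 < M.price w ∧ M.IsAttainable G (M.supply w) m := by
  have hnonneg (hp : 0 < M.price w) : 0 ≤ w m ↔ M.supply w m ≤ M.totalDemand := by
    rw [← price_mul_totalDemand_sub_supply hp.ne' m, mul_nonneg_iff_of_pos_left hp, sub_nonneg]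
  simp only [ActionFeasible, IsAttainable]
  constructor
  · rintro ⟨hw, hp, hcap, hflow⟩
    exact ⟨hp, hcap, (hnonneg hp).1 hw, hflow⟩
  · rintro ⟨hp, hcap, hle, hflow⟩
    exact ⟨(hnonneg hp).2 hle, hp, hcap, hflow⟩

namespace IsSFE

theorem price_pos (hM : M.IsAdmissible G) (hw : M.IsSFE G w) : 0 < M.price w := by
  obtain ⟨n, hn⟩ := Finset.card_pos.1 (zero_lt_two.trans hM.two_lt_card)
  exact (hw n hn).1.2.1

theorem isFeasible (hM : M.IsAdmissible G) (hw : M.IsSFE G w) :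
    M.IsFeasible G (M.supply w) := by
  obtain ⟨n, hn⟩ := Finset.card_pos.1 (zero_lt_two.trans hM.two_lt_card)
  exact ⟨sum_supply (hw.price_pos hM).ne', fun m hm ↦ (hw m hm).1.2.2.1, (hw n hn).1.2.2.2⟩

theorem le_cost_sub_of_isAttainable (hM : M.IsAdmissible G) (hw : M.IsSFE G w) (hm : m ∈ M.gens)
    {τ : ℝ} (hτ : -1 < τ)
    (hs : M.IsAttainable G (M.supply w + τ • M.deviation (M.supply w) m) m) :
    M.price w * M.markupScale * (τ / (1 + τ)) ≤
      M.cost m (M.supply w m + τ * (M.markupScale + M.supply w m)) - M.cost m (M.supply w m) := by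
  have hp := hw.price_pos hM
  have hτ' : 0 < 1 + τ := by linarith
  obtain ⟨x, hx⟩ := exists_price_update_eq hM w hm (M.price w / (1 + τ))
  have hq : 0 < M.price (Function.update w m x) := hx ▸ div_pos hp hτ'
  have hsupply : M.supply (Function.update w m x) =
      M.supply w + τ • M.deviation (M.supply w) m := by
    rw [supply_update hm hp.ne' hq.ne', hx, div_div_cancel₀ hp.ne', add_sub_cancel_left]
  have hprofit := (hw m hm).2 x (actionFeasible_iff.2 ⟨hq, hsupply ▸ hs⟩)
  rw [profit_eq hm hq.ne', profit_eq hm hp.ne',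
    Finset.sum_update_of_notMem (Finset.notMem_erase m _), hsupply, Pi.add_apply, Pi.smul_apply,
    deviation_self, smul_eq_mul, hx] at hprofit
  have hprice : M.price w * M.markupScale * (τ / (1 + τ)) =
      M.price w * M.markupScale - M.price w / (1 + τ) * M.markupScale := by
    field_simp
    ring
  linarith

theorem price_mul_markupScale_le (hM : M.IsAdmissible G) (hw : M.IsSFE G w) (hm : m ∈ M.gens)
    {c' : ℝ} (hc : HasDerivAt (M.cost m) c' (M.supply w m))
    (hup : ∀ᶠ τ in 𝓝[>] (0 : ℝ),
      M.IsAttainable G (M.supply w + τ • M.deviation (M.supply w) m) m) :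
    M.price w * M.markupScale ≤ c' * (M.markupScale + M.supply w m) := by
  refine sub_nonneg.1 (nonneg_of_hasDerivAt_of_eventually_le (hasDerivAt_deviation_loss hc) ?_)
  filter_upwards [hup, self_mem_nhdsWithin] with τ hs hτ
  have := hw.le_cost_sub_of_isAttainable hM hm (by linarith [Set.mem_Ioi.1 hτ]) hs
  simp only [zero_mul, add_zero, zero_div, mul_zero]
  linarith

theorem le_price_mul_markupScale (hM : M.IsAdmissible G) (hw : M.IsSFE G w) (hm : m ∈ M.gens)
    {c' : ℝ} (hc : HasDerivAt (M.cost m) c' (M.supply w m))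
    (hdown : ∀ᶠ τ in 𝓝[<] (0 : ℝ),
      M.IsAttainable G (M.supply w + τ • M.deviation (M.supply w) m) m) :
    c' * (M.markupScale + M.supply w m) ≤ M.price w * M.markupScale := by
  refine sub_nonpos.1 (nonpos_of_hasDerivAt_of_eventually_le (hasDerivAt_deviation_loss hc) ?_)
  filter_upwards [hdown, Ioo_mem_nhdsLT neg_one_lt_zero] with τ hs hτ
  have := hw.le_cost_sub_of_isAttainable hM hm hτ.1 hs
  simp only [zero_mul, add_zero, zero_div, mul_zero]
  linarith

end IsSFE

theorem exists_price_eq_and_supply_eq (hM : M.IsAdmissible G) {s : V → ℝ}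
    (hs : ∑ n ∈ M.gens, s n = M.totalDemand) {p : ℝ} (hp : p ≠ 0) :
    ∃ w, M.price w = p ∧ M.supply w = s := by
  have hcard : (2 : ℝ) < M.gens.card := by exact_mod_cast hM.two_lt_card
  have hne : ((M.gens.card : ℝ) - 1) * M.totalDemand ≠ 0 :=
    (mul_pos (by linarith) hM.totalDemand_pos).ne'
  have hprice : M.price (fun n ↦ p * (M.totalDemand - s n)) = p := by
    rw [price, ← Finset.mul_sum, Finset.sum_sub_distrib, hs, Finset.sum_const, nsmul_eq_mul,
      div_eq_iff hne]
    ring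
  refine ⟨_, hprice, funext fun n ↦ ?_⟩
  rw [supply, hprice, mul_div_cancel_left₀ _ hp, sub_sub_cancel]

theorem exists_isSFE_of_marginal (hM : M.IsAdmissible G) {s c' : V → ℝ} (hs : M.IsFeasible G s)
    {p : ℝ} (hp : 0 < p)
    (hc' : ∀ m ∈ M.gens, ∀ x ∈ Set.Icc (M.slo m) (M.shi m),
      c' m * (x - s m) ≤ M.cost m x - M.cost m (s m))
    (hmarginal : ∀ m ∈ M.gens, ∀ x ∈ Set.Icc (M.slo m) (M.shi m),
      (p * M.markupScale - c' m * (M.markupScale + s m)) * (x - s m) ≤ 0) :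
    ∃ w, M.IsSFE G w := by
  obtain ⟨w, rfl, rfl⟩ := exists_price_eq_and_supply_eq hM hs.1 hp.ne'
  refine ⟨w, fun m hm ↦ ⟨actionFeasible_iff.2 ⟨hp, hs.isAttainable hM hm⟩, fun x hx ↦ ?_⟩⟩
  obtain ⟨hq, hx⟩ := actionFeasible_iff.1 hx
  rw [profit_eq hm hq.ne', profit_eq hm hp.ne',
    Finset.sum_update_of_notMem (Finset.notMem_erase m _)]
  have hrevenue := (price_mul_markupScale_add_supply hm hq.ne').trans
    (Finset.sum_update_of_notMem (Finset.notMem_erase m _) w x)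
  rw [← price_mul_markupScale_add_supply hm hp.ne'] at hrevenue
  set q := M.price (Function.update w m x)
  set p := M.price w
  set E := M.markupScale
  set y := M.supply (Function.update w m x) m
  set z := M.supply w m
  have hE : 0 < E := hM.markupScale_pos
  have hEz : 0 < E + z := add_pos_of_pos_of_nonneg hE ((hM.slo_nonneg m hm).trans (hs.2.1 m hm).1)
  suffices (p - q) * E ≤ c' m * (y - z) by linarith [hc' m hm y hx.1]
  have hdiff : (p - q) * (E + z) = q * (y - z) := by linarith
  refine le_of_mul_le_mul_right ?_ hEz
  have hsign : 0 ≤ (p - q) * (y - z) := by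
    refine nonneg_of_mul_nonneg_left (b := E + z) ?_ hEz
    calc 0 ≤ q * (y - z) ^ 2 := by positivity
      _ = (p - q) * (y - z) * (E + z) := by linear_combination -(y - z) * hdiff
  calc (p - q) * E * (E + z) = q * E * (y - z) := by linear_combination E * hdiff
    _ ≤ p * E * (y - z) := by linarith [mul_nonneg hE.le hsign]
    _ ≤ c' m * (y - z) * (E + z) := by linarith [hmarginal m hm y hx.1]

end Equilibrium

section EffectiveFlow

variable {P : NeighborPartition G} {n : V}

theorem effFlow_le (m : V) : M.effFlow P n m ≤ M.f s(n, m) := by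
  rw [effFlow]
  split_ifs
  exacts [le_rfl, min_le_left _ _]

theorem effFlow_nonneg (hf : ∀ e, 0 ≤ M.f e) (hB : ∀ e, 0 ≤ M.B e) (m : V) :
    0 ≤ M.effFlow P n m := by
  rw [effFlow]
  split_ifs
  · exact hf _
  · exact le_min (hf _)
      (mul_nonneg (Finset.sum_nonneg fun e _ ↦ div_nonneg (hf e) (hB e)) (hB _))

theorem demand_le_networkTerm (hf : ∀ e, 0 ≤ M.f e) (hB : ∀ e, 0 ≤ M.B e) :
    M.d n ≤ M.networkTerm P n :=
  le_add_of_nonneg_right (Finset.sum_nonneg fun m _ ↦ effFlow_nonneg hf hB m)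

theorem networkTerm_le {a : ℝ} (hf : ∀ m, G.Adj n m → M.f s(n, m) ≤ a) :
    M.networkTerm P n ≤ M.d n + G.degree n * a := by
  rw [← nsmul_eq_mul, ← G.card_neighborFinset_eq_degree]
  exact add_le_add_right (Finset.sum_le_card_nsmul _ _ _ fun m hm ↦
    (effFlow_le m).trans (hf m ((G.mem_neighborFinset n m).1 hm))) _

theorem networkBound_eq_of_forall_le (hM : M.IsAdmissible G) (hn : n ∈ M.gens)
    (hle : ∀ m ∈ M.gens, M.networkTerm P m ≤ M.networkTerm P n) :
    M.networkBound P = 1 + M.networkTerm P n / M.markupScale := by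
  have := Nonempty.intro (⟨n, hn⟩ : M.gens)
  have hE := hM.markupScale_pos.le
  refine congrArg (1 + ·) (ciSup_eq_of_forall_le_of_forall_lt_exists_gt
    (fun m ↦ div_le_div_of_nonneg_right (hle m m.2) hE) fun x hx ↦ ⟨⟨n, hn⟩, hx⟩)

theorem bound_eq_of_forall_le (hM : M.IsAdmissible G) (hn : n ∈ M.gens)
    (hle : ∀ m ∈ M.gens, M.networkTerm P m ≤ M.networkTerm P n)
    (hcap : M.networkTerm P n ≤ M.shi n)
    (hres : M.networkTerm P n ≤ M.totalDemand - ∑ m ∈ M.gens.erase n, M.slo m) :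
    M.bound P = 1 + M.networkTerm P n / M.markupScale := by
  have := Nonempty.intro (⟨n, hn⟩ : M.gens)
  have hE := hM.markupScale_pos.le
  refine congrArg (1 + ·) (ciSup_eq_of_forall_le_of_forall_lt_exists_gt
    (fun m ↦ div_le_div_of_nonneg_right
      (((min_le_right _ _).trans (min_le_right _ _)).trans (hle m m.2)) hE)
    fun x hx ↦ ⟨⟨n, hn⟩, ?_⟩)
  rw [min_eq_right hres, min_eq_right hcap]
  exact hx

end EffectiveFlow

end Market

variable {V : Type*} [Fintype V]

/-- The data from which an extremal market on the network `G` is built: a node `hub` that can be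
removed without disconnecting the network, which will have almost all of the demand, and the
total demand `D`, which is going to be large. -/
structure HubDesign (G : SimpleGraph V) where
  hub : V
  D : ℝ
  connected : G.Connected
  reachable : ∀ i j, i ≠ hub → j ≠ hub → (G.deleteIncidenceSet hub).Reachable i j
  three_le_card : (3 : ℝ) ≤ Fintype.card V
  four_mul_card_le : 4 * (Fintype.card V : ℝ) ≤ D

namespace HubDesign

variable {G : SimpleGraph V}

theorem exists_le_D (hconn : G.Connected) (hcard : 3 ≤ Fintype.card V) (a : ℝ) :
    ∃ X : HubDesign G, a ≤ X.D := by
  have : Nontrivial V := Fintype.one_lt_card_iff_nontrivial.1 (by omega)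
  obtain ⟨v, hv⟩ := hconn.exists_connected_induce_compl_singleton_of_finite_nontrivial
  let f : G.induce {v}ᶜ →g G.deleteIncidenceSet v :=
    ⟨Subtype.val, fun {i j} hij ↦ G.deleteIncidenceSet_adj.2 ⟨hij, i.2, j.2⟩⟩
  exact ⟨⟨v, max (4 * Fintype.card V) a, hconn,
    fun i j hi hj ↦ (hv.preconnected ⟨i, hi⟩ ⟨j, hj⟩).map f, by exact_mod_cast hcard,
    le_max_left _ _⟩, le_max_right _ _⟩

variable (X : HubDesign G)

section Parameters

/-- The lower capacity limit of the suppliers other than the hub. -/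
noncomputable def σ : ℝ := 1 / X.D

/-- The least joint supply of the suppliers other than the hub. -/
noncomputable def reserve : ℝ := (Fintype.card V - 1) * X.σ

/-- The lower capacity limit of the hub, one unit below what the others leave to it at most; up to
there its production is almost free. -/
noncomputable def threshold : ℝ := X.D - X.reserve - 1

/-- The markup scale `(|𝒩_g| - 2) * D` of the market. -/
noncomputable def scale : ℝ := (Fintype.card V - 2) * X.D

/-- The marginal cost of the suppliers other than the hub. It is chosen such that the marginal costs
perceived by the hub at `threshold` and by the others at `σ + 1` agree. -/
noncomputable def slope : ℝ := (X.scale + X.threshold) / (X.scale + X.σ + 1)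

theorem D_pos : 0 < X.D := by linarith [X.three_le_card, X.four_mul_card_le]

theorem σ_pos : 0 < X.σ := one_div_pos.2 X.D_pos

theorem D_mul_σ : X.D * X.σ = 1 := mul_one_div_cancel X.D_pos.ne'

theorem card_mul_σ_le : Fintype.card V * X.σ ≤ 1 / 4 := by
  rw [σ, mul_one_div, div_le_iff₀ X.D_pos]
  linarith [X.four_mul_card_le]

theorem σ_lt_reserve : X.σ < X.reserve := by
  rw [reserve]
  nlinarith [X.σ_pos, X.three_le_card]

theorem card_sub_one_mul_σ_add_div (a : ℝ) :
    (Fintype.card V - 1) * (X.σ + a / (Fintype.card V - 1)) = X.reserve + a := by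
  rw [mul_add, mul_div_cancel₀ _ (by linarith [X.three_le_card]), reserve]

theorem reserve_add_σ_le : X.reserve + X.σ ≤ 1 / 4 := by
  rw [reserve]
  linarith [X.card_mul_σ_le]

theorem threshold_pos : 0 < X.threshold := by
  rw [threshold]
  linarith [X.three_le_card, X.four_mul_card_le, X.reserve_add_σ_le, X.σ_pos]

theorem D_le_scale : X.D ≤ X.scale := by
  rw [scale]
  nlinarith [X.three_le_card, X.D_pos]

theorem slope_mul : X.slope * (X.scale + X.σ + 1) = X.scale + X.threshold :=
  div_mul_cancel₀ _ (by linarith [X.D_le_scale, X.D_pos, X.σ_pos])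

theorem one_lt_slope : 1 < X.slope := by
  rw [slope, one_lt_div (by linarith [X.D_le_scale, X.D_pos, X.σ_pos]), threshold]
  linarith [X.three_le_card, X.four_mul_card_le, X.reserve_add_σ_le]

theorem slope_lt_two : X.slope < 2 := by
  rw [slope, div_lt_iff₀ (by linarith [X.D_le_scale, X.D_pos, X.σ_pos]), threshold]
  linarith [X.D_le_scale, X.σ_lt_reserve, X.σ_pos]

/-- The cost of producing `threshold` units at the hub. -/
noncomputable def thresholdCost : ℝ := X.threshold / (⌈X.D ^ 2⌉₊ + 1)

theorem thresholdCost_pos : 0 < X.thresholdCost := div_pos X.threshold_pos (by positivity)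

theorem thresholdCost_le : X.thresholdCost ≤ X.σ := by
  rw [thresholdCost, σ, div_le_div_iff₀ (by positivity) X.D_pos, threshold]
  nlinarith [X.σ_lt_reserve, X.σ_pos, X.D_pos, Nat.le_ceil (X.D ^ 2)]

/-- The price of anarchy of the extremal market. -/
noncomputable def poA : ℝ :=
  (X.thresholdCost + X.slope * (X.reserve + 1)) / (X.thresholdCost + 1 + X.slope * X.reserve)

theorem abs_poA_sub_slope_le : |X.poA - X.slope| ≤ 3 * Fintype.card V / X.D := by
  have hc := X.thresholdCost_pos
  have hγ := X.one_lt_slope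
  have hγ' := X.slope_lt_two
  have hz := X.σ_pos.trans X.σ_lt_reserve
  have hdiff : X.poA - X.slope = -((X.thresholdCost + X.slope * X.reserve) * (X.slope - 1) /
      (X.thresholdCost + 1 + X.slope * X.reserve)) := by
    rw [poA]
    field_simp
    ring
  rw [hdiff, abs_neg, abs_of_nonneg (div_nonneg
    (mul_nonneg (by positivity) (sub_nonneg.2 hγ.le)) (by positivity))]
  calc (X.thresholdCost + X.slope * X.reserve) * (X.slope - 1) /
        (X.thresholdCost + 1 + X.slope * X.reserve)
      ≤ (X.thresholdCost + X.slope * X.reserve) * 1 / 1 := by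
        gcongr
        · linarith
        · linarith [mul_pos (zero_lt_one.trans hγ) hz]
    _ ≤ X.σ + 2 * X.reserve := by
      rw [mul_one, div_one]
      gcongr
      exact X.thresholdCost_le
    _ ≤ 3 * Fintype.card V / X.D := by
      rw [reserve, σ, mul_one_div, ← mul_div_assoc, ← add_div]
      gcongr
      · exact X.D_pos.le
      · linarith [X.three_le_card]

end Parameters

variable [DecidableEq V]

/-- The admittances of the lines away from the hub are so large that no supplier can reverse the
flow on a line of the hub. -/
noncomputable def admittance : Sym2 V → ℝ :=
  hubAdmittance X.hub ((Fintype.card V : ℝ) ^ 3 * X.D ^ 2)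

theorem admittance_pos (e : Sym2 V) : 0 < X.admittance e := by
  have := X.D_pos
  have := X.three_le_card
  exact hubAdmittance_pos (by positivity) e

section EvenSupply

/-- The profile in which every supplier other than the hub produces `x` and the hub the rest. -/
noncomputable def evenSupply (x : ℝ) : V → ℝ :=
  Function.update (fun _ ↦ x) X.hub (X.D - (Fintype.card V - 1) * x)

theorem evenSupply_hub (x : ℝ) : X.evenSupply x X.hub = X.D - (Fintype.card V - 1) * x :=
  Function.update_self _ _ _

theorem evenSupply_of_ne (x : ℝ) {i : V} (hi : i ≠ X.hub) : X.evenSupply x i = x :=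
  Function.update_of_ne hi _ _

theorem evenSupply_σ_hub : X.evenSupply X.σ X.hub = X.threshold + 1 := by
  rw [evenSupply_hub, threshold, reserve, sub_add_cancel]

theorem card_erase_hub : ((Finset.univ.erase X.hub).card : ℝ) = Fintype.card V - 1 := by
  rw [Finset.card_erase_of_mem (Finset.mem_univ _), Finset.card_univ,
    Nat.cast_sub (Fintype.card_pos_iff.2 ⟨X.hub⟩), Nat.cast_one]

theorem sum_erase_hub {s : V → ℝ} {x : ℝ} (hs : ∀ i, i ≠ X.hub → s i = x) :
    ∑ i ∈ Finset.univ.erase X.hub, s i = (Fintype.card V - 1) * x := by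
  rw [Finset.sum_congr rfl fun i hi ↦ hs i (Finset.ne_of_mem_erase hi), Finset.sum_const,
    nsmul_eq_mul, card_erase_hub]

theorem sum_evenSupply (x : ℝ) : ∑ i, X.evenSupply x i = X.D := by
  rw [← Finset.add_sum_erase _ _ (Finset.mem_univ X.hub), evenSupply_hub,
    X.sum_erase_hub fun _ ↦ X.evenSupply_of_ne x, sub_add_cancel]

end EvenSupply

variable [DecidableRel G.Adj]

section Market

/-- The extremal market. The demands are chosen such that the profile `evenSupply σ` sends one
unit, which is the flow limit, along every line of the hub towards its other end. -/
noncomputable def market : Market V where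
  d := X.evenSupply X.σ - netOutflow G X.admittance (Pi.single X.hub 1)
  gens := Finset.univ
  cost := Function.update (fun _ s ↦ X.slope * s) X.hub (hockeyCost X.threshold ⌈X.D ^ 2⌉₊)
  slo := Function.update (fun _ ↦ X.σ) X.hub X.threshold
  shi _ := 2 * X.D
  f e := if X.hub ∈ e then 1 else 2
  B := X.admittance

theorem totalDemand_market : X.market.totalDemand = X.D := by
  simp only [Market.totalDemand, market, Pi.sub_apply, Finset.sum_sub_distrib, sum_netOutflow,
    sum_evenSupply, sub_zero]

theorem markupScale_market : X.market.markupScale = X.scale := by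
  rw [Market.markupScale, totalDemand_market]
  rfl

theorem cost_market_hub : X.market.cost X.hub = hockeyCost X.threshold ⌈X.D ^ 2⌉₊ := by
  simp [market]

theorem cost_market_of_ne {i : V} (hi : i ≠ X.hub) : X.market.cost i = fun s ↦ X.slope * s := by
  simp [market, hi]

theorem slo_market_hub : X.market.slo X.hub = X.threshold := by
  simp [market]

theorem slo_market_of_ne {i : V} (hi : i ≠ X.hub) : X.market.slo i = X.σ := by
  simp [market, hi]

theorem demand_market_hub : X.market.d X.hub = X.threshold + 1 - G.degree X.hub := by
  rw [← evenSupply_σ_hub, ← netOutflow_hubAdmittance_single_self]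
  rfl

theorem demand_market_of_ne {i : V} (hi : i ≠ X.hub) :
    X.σ ≤ X.market.d i ∧ X.market.d i ≤ X.σ + 1 := by
  have hd : X.market.d i = X.σ - if G.Adj i X.hub then -1 else 0 := by
    rw [← netOutflow_hubAdmittance_single_of_ne _ hi, ← X.evenSupply_of_ne X.σ hi]
    rfl
  rw [hd]
  split_ifs <;> constructor <;> linarith

end Market

section Flow

variable {X}

theorem isAngle_single_add {s θ : V → ℝ}
    (hθ : netOutflow G X.admittance θ = s - X.evenSupply X.σ) :
    X.market.IsAngle G s (Pi.single X.hub 1 + θ) := by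
  intro i
  have h := congrFun (map_add (netOutflow G X.admittance) (Pi.single X.hub 1) θ) i
  rw [hθ] at h
  refine h.trans ?_
  simp only [Market.injection, market, Finset.mem_univ, if_true, Pi.add_apply, Pi.sub_apply]
  ring

theorem forall_adj_lineFlow {r : ℝ → ℝ → Prop} {θ : V → ℝ}
    (hhub : ∀ j, G.Adj X.hub j → r |1 + lineFlow X.admittance θ X.hub j| 1)
    (hother : ∀ i j, G.Adj i j → r |lineFlow X.admittance θ i j| 2) (i j : V) (hij : G.Adj i j) :
    r |lineFlow X.admittance (Pi.single X.hub 1 + θ) i j| (X.market.f s(i, j)) := by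
  have hflow (j : V) (hj : G.Adj X.hub j) :
      lineFlow X.admittance (Pi.single X.hub 1 + θ) X.hub j =
        1 + lineFlow X.admittance θ X.hub j := by
    simp only [admittance, lineFlow_hubAdmittance, Pi.add_apply, Pi.single_eq_same,
      Pi.single_eq_of_ne hj.ne']
    ring
  by_cases hi : i = X.hub
  · subst hi
    simpa [hflow j hij, market] using hhub j hij
  by_cases hj : j = X.hub
  · subst hj
    rw [lineFlow_swap, abs_neg, hflow i hij.symm]
    simpa [market] using hhub i hij.symm
  · simpa [lineFlow, market, hi, hj, Ne.symm hi, Ne.symm hj] using hother i j hij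

variable (X) in
theorem exists_netOutflow_eq_sub {s s' : V → ℝ} (hs : ∑ i, s i = ∑ i, s' i) :
    ∃ θ, netOutflow G X.admittance θ = s - s' :=
  exists_netOutflow_eq X.connected (fun e _ ↦ X.admittance_pos e) (by simp [hs])

theorem abs_lineFlow_le {θ : V → ℝ} (hθ : ∀ i, i ≠ X.hub → 0 ≤ netOutflow G X.admittance θ i)
    {i j : V} (hij : G.Adj i j) :
    |lineFlow X.admittance θ i j| ≤ -netOutflow G X.admittance θ X.hub := by
  rw [← sum_posPart_netOutflow hθ]
  exact abs_lineFlow_le_sum_posPart (fun e _ ↦ (X.admittance_pos e).le) θ hij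

theorem lineFlow_neg {θ : V → ℝ}
    (hθ : (∑ i, (netOutflow G X.admittance θ i)⁺) <
      Fintype.card V * X.D ^ 2 * -netOutflow G X.admittance θ X.hub)
    {j : V} (hj : G.Adj X.hub j) : lineFlow X.admittance θ X.hub j < 0 := by
  have hD := X.D_pos
  have hcard := X.three_le_card
  refine lineFlow_hub_neg X.reachable (by positivity) ?_ hj
  rw [← mul_div_assoc, div_lt_iff₀ (by positivity)]
  calc _ < (Fintype.card V : ℝ) ^ 2 *
        (Fintype.card V * X.D ^ 2 * -netOutflow G X.admittance θ X.hub) := by gcongr; exact hθ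
    _ = _ := by rw [admittance]; ring

theorem lineFlow_nonpos {θ : V → ℝ} (hθ : ∀ i, i ≠ X.hub → 0 ≤ netOutflow G X.admittance θ i)
    {j : V} (hj : G.Adj X.hub j) :
    lineFlow X.admittance θ X.hub j ≤ 0 ∧
      (netOutflow G X.admittance θ X.hub ≠ 0 → lineFlow X.admittance θ X.hub j < 0) := by
  have habs := abs_lineFlow_le hθ hj
  have hneg (h : netOutflow G X.admittance θ X.hub ≠ 0) : lineFlow X.admittance θ X.hub j < 0 := by
    have hpos : 0 < -netOutflow G X.admittance θ X.hub :=
      ((abs_nonneg _).trans habs).lt_of_ne' (neg_ne_zero.2 h)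
    refine lineFlow_neg ?_ hj
    rw [sum_posPart_netOutflow hθ]
    refine lt_mul_of_one_lt_left hpos ?_
    nlinarith [X.three_le_card, X.four_mul_card_le]
  refine ⟨?_, hneg⟩
  by_cases h : netOutflow G X.admittance θ X.hub = 0
  · rw [h, neg_zero, abs_nonpos_iff] at habs
    exact habs.le
  · exact (hneg h).le

end Flow

section Feasibility

theorem slo_market_pos (i : V) : 0 < X.market.slo i := by
  rcases eq_or_ne i X.hub with rfl | hi
  · exact X.slo_market_hub ▸ X.threshold_pos
  · exact X.slo_market_of_ne hi ▸ X.σ_pos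

variable {X} {s θ : V → ℝ}

theorem netOutflow_nonneg_of_slo_le (hs : ∀ i, X.market.slo i ≤ s i)
    (hθ : netOutflow G X.admittance θ = s - X.evenSupply X.σ) {i : V} (hi : i ≠ X.hub) :
    0 ≤ netOutflow G X.admittance θ i := by
  rw [hθ, Pi.sub_apply, X.evenSupply_of_ne _ hi, ← X.slo_market_of_ne hi]
  exact sub_nonneg.2 (hs i)

theorem abs_lineFlow_le_one (hs : ∀ i, X.market.slo i ≤ s i)
    (hθ : netOutflow G X.admittance θ = s - X.evenSupply X.σ) {i j : V} (hij : G.Adj i j) :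
    |lineFlow X.admittance θ i j| ≤ 1 := by
  refine (abs_lineFlow_le (fun i ↦ netOutflow_nonneg_of_slo_le hs hθ) hij).trans ?_
  have hhub := X.slo_market_hub ▸ hs X.hub
  rw [hθ, Pi.sub_apply, evenSupply_σ_hub]
  linarith

theorem flowOK_of_netOutflow_eq (hθ : netOutflow G X.admittance θ = s - X.evenSupply X.σ)
    (hhub : ∀ j, G.Adj X.hub j → lineFlow X.admittance θ X.hub j ≤ 0)
    (habs : ∀ i j, G.Adj i j → |lineFlow X.admittance θ i j| ≤ 2) : X.market.FlowOK G s :=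
  ⟨_, isAngle_single_add hθ, forall_adj_lineFlow (r := (· ≤ ·))
    (fun j hj ↦ abs_le.2
      ⟨by linarith [(abs_le.1 (habs X.hub j hj)).1], by linarith [hhub j hj]⟩) habs⟩

theorem isFeasible_market_iff :
    X.market.IsFeasible G s ↔ ∑ i, s i = X.D ∧ ∀ i, X.market.slo i ≤ s i := by
  constructor
  · rintro ⟨hsum, hcap, -⟩
    exact ⟨hsum.trans X.totalDemand_market, fun i ↦ (hcap i (Finset.mem_univ i)).1⟩
  rintro ⟨hsum, hs⟩
  obtain ⟨θ, hθ⟩ := X.exists_netOutflow_eq_sub (hsum.trans (X.sum_evenSupply X.σ).symm)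
  have hcap (i : V) : s i ≤ 2 * X.D := by
    have hle := Finset.single_le_sum (fun j _ ↦ (X.slo_market_pos j).le.trans (hs j))
      (Finset.mem_univ i)
    linarith [X.D_pos]
  exact ⟨hsum.trans X.totalDemand_market.symm, fun i _ ↦ ⟨hs i, hcap i⟩, flowOK_of_netOutflow_eq hθ
    (fun j hj ↦ (lineFlow_nonpos (fun i ↦ netOutflow_nonneg_of_slo_le hs hθ) hj).1)
    fun i j hij ↦ (abs_lineFlow_le_one hs hθ hij).trans one_le_two⟩

variable (X) in
theorem isFeasible_evenSupply {x : ℝ} (hx : X.σ ≤ x)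
    (hx' : (Fintype.card V - 1) * x ≤ X.reserve + 1) :
    X.market.IsFeasible G (X.evenSupply x) := by
  refine isFeasible_market_iff.2 ⟨X.sum_evenSupply x, fun i ↦ ?_⟩
  rcases eq_or_ne i X.hub with rfl | hi
  · rw [slo_market_hub, evenSupply_hub, threshold]
    linarith
  · rwa [X.slo_market_of_ne hi, X.evenSupply_of_ne _ hi]

variable (X) in
theorem flowStrict_evenSupply {x : ℝ} (hx : X.σ < x)
    (hx' : (Fintype.card V - 1) * x ≤ X.reserve + 1) :
    X.market.FlowStrict G (X.evenSupply x) := by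
  have hs := (isFeasible_market_iff.1 (X.isFeasible_evenSupply hx.le hx')).2
  obtain ⟨θ, hθ⟩ := X.exists_netOutflow_eq_sub
    ((X.sum_evenSupply x).trans (X.sum_evenSupply X.σ).symm)
  have hinj : netOutflow G X.admittance θ X.hub ≠ 0 := by
    rw [hθ, Pi.sub_apply, evenSupply_hub, evenSupply_hub]
    nlinarith [X.three_le_card]
  refine ⟨_, isAngle_single_add hθ, forall_adj_lineFlow (r := (· < ·)) (fun j hj ↦ ?_)
    fun i j hij ↦ (abs_lineFlow_le_one hs hθ hij).trans_lt one_lt_two⟩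
  have hneg := (lineFlow_nonpos (fun i ↦ netOutflow_nonneg_of_slo_le hs hθ) hj).2 hinj
  have habs := (abs_le.1 (abs_lineFlow_le_one hs hθ hj)).1
  exact abs_lt.2 ⟨by linarith, by linarith⟩

variable (X)

theorem exists_strictlyFeasible : ∃ s : V → ℝ, ∑ i, s i = X.D ∧
    (∀ i, X.market.slo i < s i ∧ s i < 2 * X.D) ∧ X.market.FlowStrict G s := by
  have hN : (0 : ℝ) < Fintype.card V - 1 := by linarith [X.three_le_card]
  have hy : 0 < (1 / 2 : ℝ) / (Fintype.card V - 1) := by positivity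
  have hsum := X.card_sub_one_mul_σ_add_div (1 / 2)
  set y := (1 / 2 : ℝ) / (Fintype.card V - 1)
  refine ⟨_, X.sum_evenSupply (X.σ + y), fun i ↦ ?_,
    X.flowStrict_evenSupply (by linarith) (by linarith)⟩
  have hσ := X.σ_lt_reserve
  have hσ' := X.reserve_add_σ_le
  have hD := X.four_mul_card_le
  have hyle : y ≤ 1 := (div_le_one hN).2 (by linarith [X.three_le_card])
  rcases eq_or_ne i X.hub with rfl | hi
  · rw [slo_market_hub, evenSupply_hub, hsum, threshold]
    constructor <;> linarith [X.σ_pos]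
  · rw [X.slo_market_of_ne hi, X.evenSupply_of_ne _ hi]
    constructor <;> linarith [X.three_le_card]

theorem demand_market_nonneg (i : V) : 0 ≤ X.market.d i := by
  rcases eq_or_ne i X.hub with rfl | hi
  · rw [demand_market_hub, threshold]
    linarith [degree_add_one_le_card G X.hub, X.reserve_add_σ_le, X.σ_pos, X.four_mul_card_le,
      X.three_le_card]
  · exact X.σ_pos.le.trans (X.demand_market_of_ne hi).1

theorem forall_cost_market {p : (ℝ → ℝ) → Prop} (hhub : p (hockeyCost X.threshold ⌈X.D ^ 2⌉₊))
    (hother : p fun s ↦ X.slope * s) (i : V) : p (X.market.cost i) := by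
  rcases eq_or_ne i X.hub with rfl | hi
  · rwa [cost_market_hub]
  · rwa [X.cost_market_of_ne hi]

theorem isAdmissible_market : X.market.IsAdmissible G where
  demand_nonneg := X.demand_market_nonneg
  totalDemand_pos := X.totalDemand_market ▸ X.D_pos
  two_lt_card := by
    have h : 3 ≤ Fintype.card V := by exact_mod_cast X.three_le_card
    exact h
  cost_zero i _ := X.forall_cost_market (p := fun c ↦ c 0 = 0) hockeyCost_zero (mul_zero _) i
  cost_convex i _ := X.forall_cost_market
    ((convexOn_hockeyCost X.threshold_pos.le).subset (Set.subset_univ _) (convex_Ici 0))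
    ((convexOn_id (convex_Ici 0)).smul (zero_lt_one.trans X.one_lt_slope).le) i
  cost_strictMono i _ := X.forall_cost_market (p := (StrictMonoOn · (Set.Ici 0)))
    (strictMonoOn_hockeyCost X.threshold_pos)
    ((strictMono_mul_left_of_pos (zero_lt_one.trans X.one_lt_slope)).strictMonoOn _) i
  cost_differentiable i _ := X.forall_cost_market (p := (DifferentiableOn ℝ · (Set.Ici 0)))
    (fun s _ ↦ (hasDerivAt_hockeyCost s).differentiableAt.differentiableWithinAt)
    (differentiableOn_id.const_mul X.slope) i
  slo_nonneg i _ := (X.slo_market_pos i).le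
  admittance_pos e _ := X.admittance_pos e
  flowLimit_nonneg e _ := by
    simp only [market]
    split_ifs <;> norm_num
  dispensable i _ := by
    have hcard : (Fintype.card V : ℝ) ≤ (Finset.univ.erase i).card + 1 := by
      exact_mod_cast (Finset.card_erase_add_one (Finset.mem_univ i)).ge
    rw [totalDemand_market]
    simp only [market, Finset.sum_const, nsmul_eq_mul]
    nlinarith [X.three_le_card, X.D_pos]
  strictly_feasible := by
    rw [totalDemand_market]
    exact X.exists_strictlyFeasible.imp fun s hs ↦ ⟨hs.1, fun i _ ↦ hs.2.1 i, hs.2.2⟩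

end Feasibility

section Cost

variable {X} {s : V → ℝ}

theorem totalCost_eq (hs : X.market.IsFeasible G s) :
    X.market.totalCost s =
      X.thresholdCost + (s X.hub - X.threshold) + X.slope * (X.D - s X.hub) := by
  obtain ⟨hsum, hslo⟩ := isFeasible_market_iff.1 hs
  have hother : ∑ i ∈ Finset.univ.erase X.hub, X.market.cost i (s i) =
      X.slope * ∑ i ∈ Finset.univ.erase X.hub, s i := by
    rw [Finset.mul_sum]
    exact Finset.sum_congr rfl fun i hi ↦ by rw [X.cost_market_of_ne (Finset.ne_of_mem_erase hi)]
  calc X.market.totalCost s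
      = X.market.cost X.hub (s X.hub) + ∑ i ∈ Finset.univ.erase X.hub, X.market.cost i (s i) :=
        (Finset.add_sum_erase _ _ (Finset.mem_univ X.hub)).symm
    _ = _ := by
      rw [hother, Finset.sum_erase_eq_sub (Finset.mem_univ X.hub), hsum, cost_market_hub,
        hockeyCost_of_le X.threshold_pos (X.slo_market_hub ▸ hslo X.hub), thresholdCost]

theorem supply_hub_le (hs : X.market.IsFeasible G s) : s X.hub ≤ X.threshold + 1 := by
  obtain ⟨hsum, hslo⟩ := isFeasible_market_iff.1 hs
  have hother := Finset.card_nsmul_le_sum (Finset.univ.erase X.hub) s X.σ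
    fun i hi ↦ X.slo_market_of_ne (Finset.ne_of_mem_erase hi) ▸ hslo i
  rw [nsmul_eq_mul, card_erase_hub, Finset.sum_erase_eq_sub (Finset.mem_univ X.hub), hsum,
    ← reserve] at hother
  rw [threshold]
  linarith

theorem supply_le_of_ne (hs : X.market.IsFeasible G s) {m : V} (hm : m ≠ X.hub) :
    s m ≤ X.σ + 1 := by
  obtain ⟨hsum, hslo⟩ := isFeasible_market_iff.1 hs
  have hle := Finset.single_le_sum (f := fun i ↦ s i - X.market.slo i)
    (fun i _ ↦ sub_nonneg.2 (hslo i)) (Finset.mem_erase.2 ⟨hm, Finset.mem_univ m⟩)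
  rw [Finset.sum_sub_distrib, X.sum_erase_hub fun _ ↦ X.slo_market_of_ne,
    Finset.sum_erase_eq_sub (Finset.mem_univ X.hub), hsum, X.slo_market_of_ne hm, ← reserve] at hle
  have hhub := X.slo_market_hub ▸ hslo X.hub
  rw [threshold] at hhub
  linarith

variable (X)

theorem isSocialOptimum_evenSupply : X.market.IsSocialOptimum G (X.evenSupply X.σ) := by
  have hfeasible : X.market.IsFeasible G (X.evenSupply X.σ) :=
    X.isFeasible_evenSupply le_rfl (le_add_of_nonneg_right zero_le_one)
  refine ⟨hfeasible, fun s hs ↦ ?_⟩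
  rw [totalCost_eq hfeasible, totalCost_eq hs, evenSupply_σ_hub]
  nlinarith [supply_hub_le hs, X.one_lt_slope]

theorem totalCost_of_isSocialOptimum (hs : X.market.IsSocialOptimum G s) :
    X.market.totalCost s = X.thresholdCost + 1 + X.slope * X.reserve := by
  have hopt := X.isSocialOptimum_evenSupply
  rw [le_antisymm (hs.2 _ hopt.1) (hopt.2 _ hs.1), totalCost_eq hopt.1, evenSupply_σ_hub, threshold]
  ring

end Cost

section Equilibrium

theorem exists_isSFE_market : ∃ w, X.market.IsSFE G w := by
  have hN : (0 : ℝ) < Fintype.card V - 1 := by linarith [X.three_le_card]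
  have hE := X.D_pos.trans_le X.D_le_scale
  have hslope := X.one_lt_slope
  have hsum := X.card_sub_one_mul_σ_add_div 1
  have hinv : 1 / ((Fintype.card V : ℝ) - 1) ≤ 1 := by
    rw [div_le_one hN]
    linarith [X.three_le_card]
  have hσy : X.σ ≤ X.σ + 1 / ((Fintype.card V : ℝ) - 1) := le_add_of_nonneg_right (by positivity)
  set y := X.σ + 1 / ((Fintype.card V : ℝ) - 1)
  have hhub : X.evenSupply y X.hub = X.threshold := by
    rw [evenSupply_hub, hsum, threshold]
    ring
  have hprice : X.slope * (X.scale + y) / X.scale * X.scale = X.slope * (X.scale + y) :=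
    div_mul_cancel₀ _ hE.ne'
  have hmarkup : X.slope * (X.scale + y) ≤ X.scale + X.threshold := by
    rw [← slope_mul, add_assoc]
    gcongr
    linarith
  refine Market.exists_isSFE_of_marginal X.isAdmissible_market
    (c' := Function.update (fun _ ↦ X.slope) X.hub 1) (X.isFeasible_evenSupply hσy hsum.le)
    (p := X.slope * (X.scale + y) / X.scale)
    (div_pos (mul_pos (by linarith) (by linarith [X.σ_pos])) hE) ?_ ?_ <;>
    intro m _ x hx <;> rcases eq_or_ne m X.hub with rfl | hm
  · rw [slo_market_hub] at hx
    rw [Function.update_self, cost_market_hub, hhub, hockeyCost_of_le X.threshold_pos hx.1,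
      hockeyCost_self X.threshold_pos]
    linarith
  · rw [Function.update_of_ne hm, X.cost_market_of_ne hm, mul_sub]
  · rw [slo_market_hub] at hx
    rw [Function.update_self, hhub, markupScale_market, hprice]
    exact mul_nonpos_of_nonpos_of_nonneg (by linarith) (sub_nonneg.2 hx.1)
  · rw [Function.update_of_ne hm, X.evenSupply_of_ne y hm, markupScale_market, hprice, sub_self,
      zero_mul]

open Filter Topology

variable {X} {s : V → ℝ}

theorem eventually_isAttainable_deviation_hub (hs : X.market.IsFeasible G s)
    (hhub : X.threshold < s X.hub) :
    ∀ᶠ τ in 𝓝[<] (0 : ℝ), X.market.IsAttainable G (s + τ • X.market.deviation s X.hub) X.hub := by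
  have hcont : ContinuousAt (fun τ : ℝ ↦ s X.hub + τ * (X.scale + s X.hub)) 0 := by fun_prop
  have hnear := hcont.tendsto.eventually_const_lt (u := X.threshold) (by simpa using hhub)
  filter_upwards [self_mem_nhdsWithin, nhdsWithin_le_nhds hnear] with τ hτ hτ'
  refine Market.IsFeasible.isAttainable X.isAdmissible_market
    (isFeasible_market_iff.2 ⟨?_, fun i ↦ ?_⟩) (Finset.mem_univ _)
  · have hdev : ∑ i, X.market.deviation s X.hub i = 0 :=
      Market.sum_deviation (Finset.mem_univ X.hub) hs.1
    simp only [Pi.add_apply, Pi.smul_apply, smul_eq_mul, Finset.sum_add_distrib,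
      ← Finset.mul_sum, hdev, (isFeasible_market_iff.1 hs).1, mul_zero, add_zero]
  · rw [Pi.add_apply, Pi.smul_apply, smul_eq_mul]
    rcases eq_or_ne i X.hub with rfl | hi
    · rw [slo_market_hub, Market.deviation_self, markupScale_market]
      exact hτ'.le
    · rw [Market.deviation_of_ne _ _ hi]
      have hle := hs.le_totalDemand X.isAdmissible_market (Finset.mem_univ i)
      exact ((isFeasible_market_iff.1 hs).2 i).trans (le_add_of_nonneg_right
        (mul_nonneg_of_nonpos_of_nonpos (Set.mem_Iio.1 hτ).le (sub_nonpos.2 hle)))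

theorem sum_posPart_deviation (hs : X.market.IsFeasible G s) (m : V) :
    ∑ i, (X.market.deviation s m i)⁺ = X.scale + s m := by
  have hnonneg := (X.slo_market_pos m).le.trans ((isFeasible_market_iff.1 hs).2 m)
  rw [Finset.sum_eq_single m, Market.deviation_self, markupScale_market, posPart_of_nonneg]
  · linarith [X.D_le_scale, X.D_pos]
  · intro i _ hi
    rw [Market.deviation_of_ne _ _ hi, posPart_eq_zero, sub_nonpos]
    exact hs.le_totalDemand X.isAdmissible_market (Finset.mem_univ i)
  · exact fun h ↦ absurd (Finset.mem_univ m) h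

/-- If a supplier other than the hub expands, the flows on the lines of the hub turn further away
from the saturated direction. -/
theorem flowOK_add_smul_deviation (hs : X.market.IsFeasible G s) {m : V} (hm : m ≠ X.hub) {τ : ℝ}
    (hτ : 0 ≤ τ) (hτ' : τ * (X.scale + s m) ≤ 1) :
    X.market.FlowOK G (s + τ • X.market.deviation s m) := by
  obtain ⟨hsum, hslo⟩ := isFeasible_market_iff.1 hs
  obtain ⟨θ, hθ⟩ := X.exists_netOutflow_eq_sub (hsum.trans (X.sum_evenSupply X.σ).symm)
  obtain ⟨φ, hφ⟩ := exists_netOutflow_eq X.connected (fun e _ ↦ X.admittance_pos e)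
    (Market.sum_deviation (Finset.mem_univ m) hs.1)
  have hφabs {i j : V} (hij : G.Adj i j) : |lineFlow X.admittance φ i j| ≤ X.scale + s m := by
    rw [← sum_posPart_deviation hs, ← hφ]
    exact abs_lineFlow_le_sum_posPart (fun e _ ↦ (X.admittance_pos e).le) φ hij
  have hφneg {j : V} (hj : G.Adj X.hub j) : lineFlow X.admittance φ X.hub j < 0 := by
    refine lineFlow_neg ?_ hj
    have hsm := hs.le_totalDemand X.isAdmissible_market (Finset.mem_univ m)
    have hhub := supply_hub_le hs
    rw [totalDemand_market] at hsm
    rw [threshold] at hhub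
    rw [hφ, sum_posPart_deviation hs, Market.deviation_of_ne _ _ hm.symm, totalDemand_market]
    calc X.scale + s m ≤ (Fintype.card V - 2) * X.D + X.D := by rw [scale]; gcongr
      _ < Fintype.card V * X.D * (X.D * X.σ) := by rw [D_mul_σ]; linarith [X.D_pos]
      _ = Fintype.card V * X.D ^ 2 * X.σ := by ring
      _ ≤ Fintype.card V * X.D ^ 2 * -(s X.hub - X.D) := by
        gcongr
        linarith [X.σ_lt_reserve]
  refine flowOK_of_netOutflow_eq (θ := θ + τ • φ) ?_ (fun j hj ↦ ?_) fun i j hij ↦ ?_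
  · rw [map_add, map_smul, hθ, hφ]
    abel
  · rw [lineFlow_add_smul]
    exact add_nonpos (lineFlow_nonpos (fun i ↦ netOutflow_nonneg_of_slo_le hslo hθ) hj).1
      (mul_nonpos_of_nonneg_of_nonpos hτ (hφneg hj).le)
  · rw [lineFlow_add_smul]
    calc |lineFlow X.admittance θ i j + τ * lineFlow X.admittance φ i j|
        ≤ |lineFlow X.admittance θ i j| + |τ * lineFlow X.admittance φ i j| := abs_add_le _ _
      _ = |lineFlow X.admittance θ i j| + τ * |lineFlow X.admittance φ i j| := by
        rw [abs_mul, abs_of_nonneg hτ]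
      _ ≤ 1 + τ * (X.scale + s m) := by
        gcongr
        exacts [abs_lineFlow_le_one hslo hθ hij, hφabs hij]
      _ ≤ 2 := by linarith

theorem eventually_isAttainable_deviation_of_ne (hs : X.market.IsFeasible G s) {m : V}
    (hm : m ≠ X.hub) :
    ∀ᶠ τ in 𝓝[>] (0 : ℝ), X.market.IsAttainable G (s + τ • X.market.deviation s m) m := by
  have hcont : ContinuousAt (fun τ : ℝ ↦ τ * (X.scale + s m)) 0 := by fun_prop
  have hnear := hcont.tendsto.eventually_lt_const (u := 1) (by simp)
  filter_upwards [self_mem_nhdsWithin, nhdsWithin_le_nhds hnear] with τ hτ hτ'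
  have hslo := (isFeasible_market_iff.1 hs).2 m
  have hsm := supply_le_of_ne hs hm
  have hD : s m + τ * (X.scale + s m) ≤ X.D := by
    linarith [X.σ_lt_reserve, X.reserve_add_σ_le, X.σ_pos, X.four_mul_card_le, X.three_le_card]
  have hdev : (s + τ • X.market.deviation s m) m = s m + τ * (X.scale + s m) := by
    rw [Pi.add_apply, Pi.smul_apply, smul_eq_mul, Market.deviation_self, markupScale_market]
  have hpos : 0 ≤ τ * (X.scale + s m) := mul_nonneg (Set.mem_Ioi.1 hτ).le
    (by linarith [X.slo_market_pos m, X.D_le_scale, X.D_pos])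
  refine ⟨?_, ?_, flowOK_add_smul_deviation hs hm (Set.mem_Ioi.1 hτ).le hτ'.le⟩ <;> rw [hdev]
  · exact ⟨by linarith, show _ ≤ 2 * X.D by linarith [X.D_pos]⟩
  · rwa [totalDemand_market]

theorem supply_hub_of_isSFE {w : V → ℝ} (hw : X.market.IsSFE G w) :
    X.market.supply w X.hub = X.threshold := by
  have hM := X.isAdmissible_market
  have hs := hw.isFeasible hM
  have hslo := X.slo_market_hub ▸ (isFeasible_market_iff.1 hs).2 X.hub
  by_contra hne
  have hhub := lt_of_le_of_ne hslo (Ne.symm hne)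
  obtain ⟨m, hm⟩ := Fintype.exists_ne_of_one_lt_card
    (one_lt_two.trans hM.two_lt_card) X.hub
  have hcost : HasDerivAt (X.market.cost m) X.slope (X.market.supply w m) := by
    rw [X.cost_market_of_ne hm]
    simpa using (hasDerivAt_id' (X.market.supply w m)).const_mul X.slope
  have hhubprice := hw.le_price_mul_markupScale hM (Finset.mem_univ X.hub)
    (X.cost_market_hub ▸ hasDerivAt_hockeyCost_of_le X.threshold_pos hslo)
    (eventually_isAttainable_deviation_hub hs hhub)
  have hprice := hw.price_mul_markupScale_le hM (Finset.mem_univ m) hcost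
    (eventually_isAttainable_deviation_of_ne hs hm)
  rw [markupScale_market] at hhubprice hprice
  refine hhub.not_ge (le_of_add_le_add_left (a := X.scale) ?_)
  calc X.scale + X.market.supply w X.hub
      ≤ X.market.price w * X.scale := by rwa [one_mul] at hhubprice
    _ ≤ X.slope * (X.scale + X.market.supply w m) := hprice
    _ ≤ X.slope * (X.scale + X.σ + 1) := by
      rw [add_assoc]
      exact mul_le_mul_of_nonneg_left (by linarith [supply_le_of_ne hs hm])
        (zero_lt_one.trans X.one_lt_slope).le
    _ = X.scale + X.threshold := X.slope_mul

variable (X)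

theorem isPoA_market : X.market.IsPoA G X.poA := by
  refine ⟨X.exists_isSFE_market, ⟨_, X.isSocialOptimum_evenSupply⟩, fun w s hw hs ↦ ?_⟩
  rw [X.totalCost_of_isSocialOptimum hs, totalCost_eq (hw.isFeasible X.isAdmissible_market),
    supply_hub_of_isSFE hw, threshold, poA]
  ring

end Equilibrium

section Bound

variable (P : NeighborPartition G)

theorem flowLimit_market_nonneg (e : Sym2 V) : 0 ≤ X.market.f e := by
  simp only [market]
  split_ifs <;> norm_num

theorem flowLimit_market_le_two (e : Sym2 V) : X.market.f e ≤ 2 := by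
  simp only [market]
  split_ifs <;> norm_num

theorem demand_hub_le_networkTerm : X.market.d X.hub ≤ X.market.networkTerm P X.hub :=
  Market.demand_le_networkTerm X.flowLimit_market_nonneg fun e ↦ (X.admittance_pos e).le

theorem networkTerm_hub_le : X.market.networkTerm P X.hub ≤ X.threshold + 1 := by
  have h := Market.networkTerm_le (M := X.market) (P := P) (n := X.hub) (a := 1)
    fun m _ ↦ by simp [market]
  rw [demand_market_hub] at h
  linarith

theorem networkTerm_le_networkTerm_hub (n : V) :
    X.market.networkTerm P n ≤ X.market.networkTerm P X.hub := by
  rcases eq_or_ne n X.hub with rfl | hn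
  · exact le_rfl
  have hterm := Market.networkTerm_le (M := X.market) (P := P) (n := n)
    fun m _ ↦ X.flowLimit_market_le_two s(n, m)
  have hhub := X.demand_hub_le_networkTerm P
  rw [demand_market_hub, threshold] at hhub
  linarith [(X.demand_market_of_ne hn).2, degree_add_one_le_card G n,
    degree_add_one_le_card G X.hub, X.reserve_add_σ_le, X.σ_lt_reserve, X.four_mul_card_le,
    X.three_le_card]

theorem networkBound_market :
    X.market.networkBound P = 1 + X.market.networkTerm P X.hub / X.scale := by
  rw [← markupScale_market]
  exact Market.networkBound_eq_of_forall_le X.isAdmissible_market (Finset.mem_univ X.hub)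
    fun m _ ↦ X.networkTerm_le_networkTerm_hub P m

theorem bound_market : X.market.bound P = 1 + X.market.networkTerm P X.hub / X.scale := by
  have hhub := X.networkTerm_hub_le P
  rw [threshold, sub_add_cancel] at hhub
  rw [← markupScale_market]
  refine Market.bound_eq_of_forall_le X.isAdmissible_market (Finset.mem_univ X.hub)
    (fun m _ ↦ X.networkTerm_le_networkTerm_hub P m) ?_ ?_
  · exact show _ ≤ 2 * X.D by linarith [X.σ_lt_reserve, X.σ_pos, X.D_pos]
  · have hslo : ∑ m ∈ X.market.gens.erase X.hub, X.market.slo m = X.reserve :=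
      X.sum_erase_hub fun _ ↦ X.slo_market_of_ne
    rwa [totalDemand_market, hslo]

theorem abs_slope_sub_bound_le :
    |X.slope - X.market.bound P| ≤ 2 * Fintype.card V / X.D := by
  have hE := X.D_pos.trans_le X.D_le_scale
  have hT := (X.demand_market_hub ▸ X.demand_hub_le_networkTerm P :)
  have hT' := X.networkTerm_hub_le P
  have hdegree := degree_add_one_le_card G X.hub
  have hσ := X.σ_pos
  have hslope := X.slope_mul
  have hmarkup : 0 ≤ (X.slope - 1) * (X.σ + 1) ∧ (X.slope - 1) * (X.σ + 1) ≤ X.σ + 1 :=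
    ⟨mul_nonneg (by linarith [X.one_lt_slope]) (by linarith),
      mul_le_of_le_one_left (by linarith) (by linarith [X.slope_lt_two])⟩
  have hdiff : X.slope - X.market.bound P =
      ((X.slope - 1) * X.scale - X.market.networkTerm P X.hub) / X.scale := by
    rw [bound_market]
    field_simp
    ring
  rw [hdiff, abs_div, abs_of_pos hE]
  refine div_le_div₀ (by positivity) (abs_le.2 ⟨?_, ?_⟩) X.D_pos X.D_le_scale <;>
    linarith [X.three_le_card, X.σ_lt_reserve, X.reserve_add_σ_le]

theorem abs_poA_sub_bound_le :
    |X.poA - X.market.bound P| ≤ 5 * Fintype.card V / X.D := by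
  calc |X.poA - X.market.bound P|
      ≤ |X.poA - X.slope| + |X.slope - X.market.bound P| := abs_sub_le _ _ _
    _ ≤ 3 * Fintype.card V / X.D + 2 * Fintype.card V / X.D :=
      add_le_add X.abs_poA_sub_slope_le (X.abs_slope_sub_bound_le P)
    _ = 5 * Fintype.card V / X.D := by ring

end Bound

end HubDesign

end PowerMarket

theorem theorem2_general {V : Type*} [Fintype V] [DecidableEq V] (G : SimpleGraph V)
    [DecidableRel G.Adj] (hconn : G.Connected) (hcard : 3 ≤ Fintype.card V) (ε : ℝ) (hε : 0 < ε) :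
    ∃ M : PowerMarket.Market V, M.IsAdmissible G ∧ ∃ ρ : ℝ, M.IsPoA G ρ ∧
      ∀ P : PowerMarket.NeighborPartition G,
        M.bound P = M.networkBound P ∧ |ρ - M.bound P| ≤ ε := by
  obtain ⟨X, hX⟩ := PowerMarket.HubDesign.exists_le_D hconn hcard (5 * Fintype.card V / ε)
  refine ⟨X.market, X.isAdmissible_market, X.poA, X.isPoA_market, fun P ↦ ⟨?_, ?_⟩⟩
  · rw [X.bound_market, X.networkBound_market]
  · exact (X.abs_poA_sub_bound_le P).trans ((div_le_comm₀ hε X.D_pos).1 hX)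

theorem theorem2 {V : Type*} [Fintype V] [DecidableEq V] (G : SimpleGraph V) [DecidableRel G.Adj]
    (hconn : G.Connected) (hcard : 3 ≤ Fintype.card V) (hG : PowerMarket.IsWeaklyCyclic G)
    (ε : ℝ) (hε : 0 < ε) :
    Nonempty (PowerMarket.NeighborPartition G) ∧
    ∃ M : PowerMarket.Market V, M.IsAdmissible G ∧ ∃ ρ : ℝ, M.IsPoA G ρ ∧
      ∀ P : PowerMarket.NeighborPartition G,
        M.bound P = M.networkBound P ∧ |ρ - M.bound P| ≤ ε :=
  ⟨hG.nonempty_neighborPartition, theorem2_general G hconn hcard ε hε⟩
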